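/- Let $K\ge 1$, $n=100$, $D=1000$, $\sigma=8$, $\delta=0.05$, $\eta_t=1/t$, and let $u\in\mathbb R^K$ be any vector with $\big(\sum_{t=1}^{n}\eta_t\big)\|u\|^2=64$. Let $\kappa\in\{4,\,0.9\}$. The training data $S=((y_i,x_i))_{i=1}^n$ are i.i.d.: $y_i$ is uniform on $\{\pm1\}$ and $x_i=(y_iu,\,x_{i,2})\in\mathbb R^K\times\mathbb R^D$, where $x_{i,2}\sim N(0,(\sigma^2/D)I_D)$ is independent of $y_i$. Let $Z=\{\pm1\}\times\mathbb R^{K+D}$. Put $w_0=0$, $w_t=w_{t-1}+\eta_t y_t x_t$ for $t=1,\dots,n$, and $W=w_n+(0,\xi)$ with $\xi\sim N(0,\kappa I_D)$ independent of $S$. Let $Q(S)$ be the conditional law of $W$ given $S$. The loss of $w\in\mathbb R^{K+D}$ on $(y,x)$ is $0$ if $\operatorname{sign}\langle x,w\rangle=y$ and $1$ otherwise (so the prediction $0$ is a mistake). For $J\subseteq[n]$ let $S_J$ be the data with indices in $J$ and $S\setminus S_J$ the remaining data. For $\beta\in(0,1)$ and a measurable map $P$ from $Z^{|J|}$ to the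 probability measures on $\mathbb R^{K+D}$ let $$F(J,\beta,P)=\mathbb E\Big[\frac1\beta\,\hat R_{S\setminus S_J}(Q(S))+\frac{\mathrm{KL}(Q(S)\,\|\,P(S_J))+\log\frac1\delta}{2\beta(1-\beta)\,(n-|J|)}\Big]$$ be the expected linear PAC-Bayes bound, where $\hat R_{S\setminus S_J}(Q(S))$ is the average over the data in $S\setminus S_J$ of the expected loss of a classifier drawn from $Q(S)$; for $J=[n]$ the bound is $+\infty$. Let $P^*_J(S_J)=\mathbb E[Q(S)\mid S_J]$ be the oracle prior given $S_J$. Then: 1. The infimum of $F(J,\beta,P)$ over all $J\subseteq[n]$, $\beta\in(0,1)$ and $P$ is attained by some nonempty $J$, some $\beta$, and $P=P^*_J$. 2. The optimal prior is data dependent: whenever $(J,\beta,P)$ attains the infimum, $J$ is nonempty and $P(S_J)$ is not almost surely equal to a constant probability measure. 3. For $J=\emptyset$, every $\beta\in(0,1)$ and every prior $P$ (in particular the oracle prior $P^*_\emptyset=\mathbb E[Q(S)]$), $F(\emptyset,\beta,P)\ge 1.1$ if $\kappa=0.9$ (so the bound is vacuous), and $F(\emptyset,\beta,P)\ge 0.31$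 if $\kappa=4$. 4. For $J=[24]=\{1,\dots,24\}$ there is a $\beta\in(0,1)$ with $F([24],\beta,P^*_{[24]})\le 0.15$. -/

import Mathlib

open MeasureTheory ProbabilityTheory
open scoped ENNReal NNReal

noncomputable section

namespace PacBayes

/-! ### The learning problem -/

/-- Inputs and weights: `ℝ^(K+D)`, decomposed as `ℝ^K × ℝ^D`. -/
abbrev Vec (K D : ℕ) : Type := (Fin K → ℝ) × (Fin D → ℝ)

/-- Labelled examples `(y, x)` with `y ∈ {1, -1}`. -/
abbrev Example (K D : ℕ) : Type := ℤˣ × Vec K D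

/-- The Euclidean inner product of `ℝ^(K+D)`. -/
def ip {K D : ℕ} (x w : Vec K D) : ℝ := x.1 ⬝ᵥ w.1 + x.2 ⬝ᵥ w.2

/-- The linear classifier with weights `w`, with values in `{-1, 0, 1}`. -/
def classify {K D : ℕ} (w x : Vec K D) : ℝ := Real.sign (ip x w)

/-- The zero-one loss; the prediction `0` is always a mistake. -/
def loss {K D : ℕ} (w : Vec K D) (z : Example K D) : ℝ≥0∞ :=
  if classify w z.2 = ((z.1 : ℤ) : ℝ) then 0 else 1

/-- The centred Gaussian on `ℝ^D` with covariance matrix `v I`. -/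
def isoGaussian (D : ℕ) (v : ℝ≥0) : Measure (Fin D → ℝ) :=
  Measure.pi fun _ => gaussianReal 0 v

/-- The uniform distribution on the labels `{1, -1}`. -/
def labelLaw : Measure ℤˣ := (2⁻¹ : ℝ≥0∞) • (Measure.dirac 1 + Measure.dirac (-1))

/-- The law of an example: `y` is uniform, `x₁ = y u`, and `x₂` is independent of `y` and Gaussian
with covariance `(σ² / D) I`. -/
def exampleLaw {K : ℕ} (D : ℕ) (u : Fin K → ℝ) (σ : ℝ≥0) : Measure (Example K D) :=
  (labelLaw.prod (isoGaussian D (σ ^ 2 / D))).map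
    fun p => (p.1, (((p.1 : ℤ) : ℝ) • u, p.2))

/-! ### The learning algorithm -/

/-- The iterates of one-pass learning with step size `η_t = 1 / t`. The datum `s i` is used in step
`t = i + 1`. -/
def sgdIterate {n K D : ℕ} (s : Fin n → Example K D) : ℕ → Vec K D
  | 0 => 0
  | t + 1 =>
    if h : t < n then
      sgdIterate s t + (1 / ((t : ℝ) + 1)) • ((((s ⟨t, h⟩).1 : ℤ) : ℝ) • (s ⟨t, h⟩).2)
    else sgdIterate s t

/-- The final weights `w_n + (0, ξ)`, as a function of the sample and the noise. -/
def finalWeights {n K D : ℕ} (p : (Fin n → Example K D) × (Fin D → ℝ)) : Vec K D :=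
  sgdIterate p.1 n + (0, p.2)

/-- The posterior `Q(S)`: the law of `w_n + (0, ξ)` given the sample, where `ξ` is Gaussian with
covariance `κ I` and independent of the sample. -/
def sgdPosterior (n K D : ℕ) (κ : ℝ≥0) : Kernel (Fin n → Example K D) (Vec K D) :=
  (Kernel.id ×ₖ Kernel.const _ (isoGaussian D κ)).map finalWeights

/-! ### The linear PAC-Bayes bound -/

/-- The empirical risk of the Gibbs classifier `Q` on the data with indices in `T`. -/
def empRisk {n K D : ℕ} (T : Finset (Fin n)) (s : Fin n → Example K D) (Q : Measure (Vec K D)) :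
    ℝ≥0∞ :=
  (∑ i ∈ T, ∫⁻ w, loss w (s i) ∂Q) / (T.card : ℝ≥0∞)

/-- The linear PAC-Bayes bound with posterior `Q` and prior `P`, based on the data with indices
in `T`. -/
def linearBound {n K D : ℕ} (β δ : ℝ) (T : Finset (Fin n)) (s : Fin n → Example K D)
    (Q P : Measure (Vec K D)) : ℝ≥0∞ :=
  empRisk T s Q / ENNReal.ofReal β +
    (InformationTheory.klDiv Q P + ENNReal.ofReal (Real.log (1 / δ))) /
      (ENNReal.ofReal (2 * β * (1 - β)) * (T.card : ℝ≥0∞))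

/-- The expectation over the sample `S` of the linear PAC-Bayes bound for the posterior `Q(S)`
that uses the data `S_J` for the prior and the remaining data for the risk estimate. If `J` is the
whole index set, no data remain and the value is `∞` for `δ < 1`. -/
def expectedBound {n K D : ℕ} (u : Fin K → ℝ) (σ κ : ℝ≥0) (δ : ℝ) (J : Finset (Fin n)) (β : ℝ)
    (P : Kernel (J → Example K D) (Vec K D)) : ℝ≥0∞ :=
  ∫⁻ s, linearBound β δ Jᶜ s (sgdPosterior n K D κ s) (P fun i => s i)
    ∂(Measure.pi fun _ : Fin n => exampleLaw D u σ)

/-- The infimum of the expected bound over all `J ⊆ [n]`, `β ∈ (0,1)` and measurable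
`P : Z^|J| → {probability measures on the weights}`. -/
def infBound (n : ℕ) {K : ℕ} (D : ℕ) (u : Fin K → ℝ) (σ κ : ℝ≥0) (δ : ℝ) : ℝ≥0∞ :=
  ⨅ (J : Finset (Fin n)) (β : ℝ) (_ : β ∈ Set.Ioo (0 : ℝ) 1)
    (P : Kernel (J → Example K D) (Vec K D)) (_ : IsMarkovKernel P),
    expectedBound u σ κ δ J β P

/-! ### Oracle priors -/

/-- Replace the coordinates in `J` of a sample by the given data. -/
def overwrite {n K D : ℕ} (J : Finset (Fin n))
    (p : (J → Example K D) × (Fin n → Example K D)) : Fin n → Example K D :=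
  fun i => if h : i ∈ J then p.1 ⟨i, h⟩ else p.2 i

/-- The data-dependent oracle prior `P*(S_J) = E[Q(S) | S_J]`: the data in `J` are given, and
`Q(S)` is averaged over the other data, which are i.i.d. -/
def oraclePrior {n K D : ℕ} (u : Fin K → ℝ) (σ κ : ℝ≥0) (J : Finset (Fin n)) :
    Kernel (J → Example K D) (Vec K D) :=
  sgdPosterior n K D κ ∘ₖ
    (Kernel.id ×ₖ Kernel.const _ (Measure.pi fun _ : Fin n => exampleLaw D u σ)).map (overwrite J)

/-- The first `m` indices, `[m] ⊆ [n]`. -/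
def initialSegment (n m : ℕ) : Finset (Fin n) := Finset.univ.filter fun i => (i : ℕ) < m

/-! ### The measures and kernels above are probability measures and Markov kernels -/

instance isProbabilityMeasure_isoGaussian (D : ℕ) (v : ℝ≥0) :
    IsProbabilityMeasure (isoGaussian D v) := by
  unfold isoGaussian; infer_instance

instance isProbabilityMeasure_labelLaw : IsProbabilityMeasure labelLaw := by
  constructor
  simp only [labelLaw, Measure.smul_apply, Measure.add_apply, measure_univ, smul_eq_mul]
  rw [one_add_one_eq_two]
  exact ENNReal.inv_mul_cancel (by simp) (by simp)

theorem measurable_label : Measurable fun y : ℤˣ => ((y : ℤ) : ℝ) :=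
  (measurable_of_countable fun k : ℤ => (k : ℝ)).comp (comap_measurable _)

instance isProbabilityMeasure_exampleLaw {K : ℕ} (D : ℕ) (u : Fin K → ℝ) (σ : ℝ≥0) :
    IsProbabilityMeasure (exampleLaw D u σ) := by
  refine Measure.isProbabilityMeasure_map (Measurable.aemeasurable ?_)
  have h : Measurable fun p : ℤˣ × (Fin D → ℝ) => ((p.1 : ℤ) : ℝ) :=
    measurable_label.comp measurable_fst
  exact measurable_fst.prodMk ((h.smul_const u).prodMk measurable_snd)

theorem measurable_sgdIterate {n K D : ℕ} (t : ℕ) :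
    Measurable fun s : Fin n → Example K D => sgdIterate s t := by
  induction t with
  | zero => exact measurable_const
  | succ t ih =>
    by_cases h : t < n
    · simp only [sgdIterate, h, dite_true]
      have h1 : Measurable fun s : Fin n → Example K D => s ⟨t, h⟩ := measurable_pi_apply _
      have h2 : Measurable fun s : Fin n → Example K D => (((s ⟨t, h⟩).1 : ℤ) : ℝ) :=
        measurable_label.comp h1.fst
      have h3 : Measurable fun s : Fin n → Example K D =>
          (((s ⟨t, h⟩).1 : ℤ) : ℝ) • (s ⟨t, h⟩).2 := h2.smul h1.snd
      have h4 := h3.const_smul (1 / ((t : ℝ) + 1))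
      exact ih.add h4
    · simpa only [sgdIterate, h, dite_false] using ih

theorem measurable_finalWeights {n K D : ℕ} :
    Measurable (finalWeights : (Fin n → Example K D) × (Fin D → ℝ) → Vec K D) :=
  ((measurable_sgdIterate n).comp measurable_fst).add (measurable_const.prodMk measurable_snd)

theorem measurable_overwrite {n K D : ℕ} (J : Finset (Fin n)) :
    Measurable (overwrite (K := K) (D := D) J) := by
  refine measurable_pi_lambda _ fun i => ?_
  by_cases h : i ∈ J
  · simp only [overwrite, h, dite_true]
    exact (measurable_pi_apply _).comp measurable_fst
  · simp only [overwrite, h, dite_false]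
    exact (measurable_pi_apply _).comp measurable_snd

instance isMarkovKernel_sgdPosterior (n K D : ℕ) (κ : ℝ≥0) :
    IsMarkovKernel (sgdPosterior n K D κ) :=
  Kernel.IsMarkovKernel.map _ measurable_finalWeights

instance isMarkovKernel_oraclePrior {n K D : ℕ} (u : Fin K → ℝ) (σ κ : ℝ≥0)
    (J : Finset (Fin n)) : IsMarkovKernel (oraclePrior (D := D) u σ κ J) := by
  have := Kernel.IsMarkovKernel.map
    (Kernel.id ×ₖ Kernel.const (J → Example K D)
      (Measure.pi fun _ : Fin n => exampleLaw D u σ)) (measurable_overwrite J)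
  unfold oraclePrior
  infer_instance

end PacBayes

end

open PacBayes

/-!
Absorbing the label into the input turns the noise components of the examples into i.i.d. Gaussian
vectors `g_i` (`exampleLaw_map_latentNoise`). Almost surely, the signal component of the final
weights is a fixed multiple of `u`, and their noise component is `N(∑ η_i g_i, κ I)`. Hence the
posterior depends on the sample only through the mean of an isotropic Gaussian
(`sgdPosterior_apply`, `sgdIterate_fst`).

*Optimality of the oracle prior.* For fixed `J` and `β` the prior enters the expected bound only
through the expected divergence `E KL(Q(S) ‖ P(S_J))`. Given `S_J`, the prior is a constant, and the
average of a kernel is the constant reference with the least expected divergence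
(`lintegral_klDiv_comp_le`): by the chain rule, read in both orders of the joint law, the excess is
the divergence of the average from the reference. With the oracle prior, the bound has the form
`A / β + B / (2 β (1 - β) N)` with `A` finite and `B > 0`. It blows up at both ends of `(0, 1)`, so
an optimal `β` exists for each of the finitely many `J`
(`exists_expectedBound_oraclePrior_eq_infBound`).

*Lower bound for constant priors.* The expected divergence from a constant prior is least for the
average of the posteriors, whose noise component is Gaussian with variance `τ + κ`, where
`τ = σ² / D ∑ η_i²`. This gives at least `D / 2 log (1 + τ / κ)`
(`le_lintegral_klDiv_sgdPosterior`). As `2 β (1 - β) ≤ 1 / 2` and at most all `n` data are used, the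
bound is at least `2 / n (D / 2 log (1 + τ / κ) + log (1 / δ))` for every `J`
(`le_expectedBound_of_ae_eq`).

*Upper bound for `J = [24]`.* By optimality, the oracle prior may be replaced by the Gaussian of
variance `κ` centred at the contribution of `S_J`, which costs `D τ' / (2 κ)` with
`τ' = σ² / D ∑_{i > 24} η_i²` (`lintegral_klDiv_oraclePrior_le_sq`). The risk on a datum `i` outside
`J` is bounded by a Chernoff estimate: its margin is `64 + ⟨g_i, ∑ η_j g_j + ξ⟩`, in which the term
`η_i |g_i|²` is nonnegative and the remaining noise is Gaussian given `g_i` (`lintegral_loss_le`).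

The value at `J = [24]` lies below the lower bound for constant priors. Therefore neither `J = ∅`
nor a prior that is almost surely constant can be optimal.
-/

namespace PacBayes

open InformationTheory

/-! ### Kullback-Leibler divergence of kernels -/

variable {X Y : Type*} [MeasurableSpace X] [MeasurableSpace Y]

theorem measurable_klDiv_kernel [MeasurableSpace.CountableOrCountablyGenerated X Y]
    (κ η : Kernel X Y) [IsFiniteKernel κ] [IsFiniteKernel η] :
    Measurable fun x => klDiv (κ x) (η x) := by
  classical
  have h (x : X) : klDiv (κ x) (η x) = if κ x ≪ η x then
      ∫⁻ y, ENNReal.ofReal (klFun (Kernel.rnDeriv κ η x y).toReal) ∂(η x) else ∞ := by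
    rw [klDiv_eq_lintegral_klFun]
    refine if_congr Iff.rfl (lintegral_congr_ae ?_) rfl
    filter_upwards [Kernel.rnDeriv_eq_rnDeriv_measure (κ := κ) (η := η) (a := x)] with y hy
    rw [hy]
  simp_rw [h]
  refine Measurable.ite (Kernel.measurableSet_absolutelyContinuous κ η) ?_ measurable_const
  have h2 : Measurable fun p : X × Y =>
      ENNReal.ofReal (klFun (Kernel.rnDeriv κ η p.1 p.2).toReal) :=
    (measurable_klFun.comp (Kernel.measurable_rnDeriv κ η).ennreal_toReal).ennreal_ofReal
  exact h2.lintegral_kernel_prod_right'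

/-- The conditional Kullback-Leibler divergence is the average divergence of the kernels. -/
theorem klDiv_compProd_same_left [MeasurableSpace.CountableOrCountablyGenerated X Y]
    (μ : Measure X) [IsFiniteMeasure μ] (κ η : Kernel X Y) [IsMarkovKernel κ] [IsMarkovKernel η] :
    klDiv (μ ⊗ₘ κ) (μ ⊗ₘ η) = ∫⁻ x, klDiv (κ x) (η x) ∂μ := by
  by_cases hac : ∀ᵐ x ∂μ, κ x ≪ η x
  · have hf : Measurable fun p : X × Y => Kernel.rnDeriv κ η p.1 p.2 :=
      Kernel.measurable_rnDeriv κ η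
    have hd : μ ⊗ₘ κ = (μ ⊗ₘ η).withDensity fun p => Kernel.rnDeriv κ η p.1 p.2 := by
      ext s hs
      rw [withDensity_apply _ hs, Measure.compProd_apply hs, ← lintegral_indicator hs,
        Measure.lintegral_compProd (hf.indicator hs)]
      refine lintegral_congr_ae ?_
      filter_upwards [hac] with x hx
      have hsx : MeasurableSet (Prod.mk x ⁻¹' s) := measurable_prodMk_left hs
      rw [← Kernel.setLIntegral_rnDeriv hx hsx, ← lintegral_indicator hsx]
      rfl
    have hac' : μ ⊗ₘ κ ≪ μ ⊗ₘ η := Measure.absolutelyContinuous_compProd_right_iff.2 hac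
    have hr : (μ ⊗ₘ κ).rnDeriv (μ ⊗ₘ η) =ᵐ[μ ⊗ₘ η] fun p => Kernel.rnDeriv κ η p.1 p.2 := by
      rw [hd]
      exact Measure.rnDeriv_withDensity _ hf
    rw [klDiv_eq_lintegral_klFun_of_ac hac']
    calc _ = ∫⁻ p, ENNReal.ofReal (klFun (Kernel.rnDeriv κ η p.1 p.2).toReal) ∂(μ ⊗ₘ η) := by
          refine lintegral_congr_ae ?_
          filter_upwards [hr] with p hp using by rw [hp]
      _ = ∫⁻ x, ∫⁻ y, ENNReal.ofReal (klFun (Kernel.rnDeriv κ η x y).toReal) ∂(η x) ∂μ :=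
          Measure.lintegral_compProd
            (measurable_klFun.comp hf.ennreal_toReal).ennreal_ofReal
      _ = _ := by
          refine lintegral_congr_ae ?_
          filter_upwards [hac] with x hx
          rw [klDiv_eq_lintegral_klFun_of_ac hx]
          refine lintegral_congr_ae ?_
          filter_upwards [Kernel.rnDeriv_eq_rnDeriv_measure (κ := κ) (η := η) (a := x)] with y hy
          rw [hy]
  · rw [klDiv_of_not_ac (by rwa [Measure.absolutelyContinuous_compProd_right_iff])]
    symm
    by_contra hne
    exact hac ((ae_lt_top (measurable_klDiv_kernel κ η) hne).mono fun x hx => by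
      by_contra h
      rw [klDiv_of_not_ac h] at hx
      exact lt_irrefl _ hx)

/-- The average `κ ∘ₘ μ` of a kernel minimises the expected divergence among all constant
references. The gap is the divergence of the average from the reference, by the chain rule for the
joint law read in the reversed order. -/
theorem lintegral_klDiv_comp_le [StandardBorelSpace X] [Nonempty X]
    [MeasurableSpace.CountableOrCountablyGenerated X Y]
    (μ : Measure X) [IsProbabilityMeasure μ] (κ : Kernel X Y) [IsMarkovKernel κ]
    (p : Measure Y) [IsProbabilityMeasure p] :
    ∫⁻ x, klDiv (κ x) (κ ∘ₘ μ) ∂μ ≤ ∫⁻ x, klDiv (κ x) p ∂μ := by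
  -- divergence is invariant under exchanging the two coordinates
  have hswap (ρ ρ' : Measure (X × Y)) [IsFiniteMeasure ρ] [IsFiniteMeasure ρ'] :
      klDiv (ρ.map Prod.swap) (ρ'.map Prod.swap) = klDiv ρ ρ' := by
    refine le_antisymm (klDiv_map_le _ _ measurable_swap) ?_
    have h := klDiv_map_le (ρ.map Prod.swap) (ρ'.map Prod.swap) (g := Prod.swap)
      measurable_swap
    simpa [Measure.map_map measurable_swap measurable_swap] using h
  -- the joint law in reversed order, with the posterior kernel `κ†μ` of Bayes' rule
  have hconst (q : Measure Y) [IsProbabilityMeasure q] :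
      ∫⁻ x, klDiv (κ x) q ∂μ = klDiv ((κ ∘ₘ μ) ⊗ₘ κ†μ) (q ⊗ₘ Kernel.const Y μ) := by
    have h1 := klDiv_compProd_same_left μ κ (Kernel.const X q)
    simp only [Kernel.const_apply] at h1
    rw [← h1, ← hswap, compProd_posterior_eq_map_swap, Measure.compProd_const,
      Measure.compProd_const, Measure.prod_swap]
  rw [hconst, hconst, klDiv_compProd_eq_add (κ ∘ₘ μ) p]
  exact le_add_self

/-! ### Isotropic Gaussians -/

/-- The Gaussian on `ℝ^D` with mean `m` and covariance matrix `v I`. -/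
noncomputable def shiftedGaussian {D : ℕ} (m : Fin D → ℝ) (v : ℝ≥0) : Measure (Fin D → ℝ) :=
  Measure.pi fun d => gaussianReal (m d) v

instance isProbabilityMeasure_shiftedGaussian {D : ℕ} (m : Fin D → ℝ) (v : ℝ≥0) :
    IsProbabilityMeasure (shiftedGaussian m v) := by
  unfold shiftedGaussian; infer_instance

theorem shiftedGaussian_zero (D : ℕ) (v : ℝ≥0) :
    shiftedGaussian (0 : Fin D → ℝ) v = isoGaussian D v := rfl

theorem isoGaussian_map_add {D : ℕ} (m : Fin D → ℝ) (v : ℝ≥0) :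
    (isoGaussian D v).map (fun x => m + x) = shiftedGaussian m v := by
  have h := Measure.pi_map_pi (μ := fun _ : Fin D => gaussianReal 0 v)
    (f := fun d x => m d + x) (fun d => (measurable_const_add (m d)).aemeasurable)
  simp only [gaussianReal_map_const_add, zero_add] at h
  exact h

theorem isoGaussian_map_smul {D : ℕ} (c : ℝ) (v : ℝ≥0) :
    (isoGaussian D v).map (fun x => c • x) = isoGaussian D (.mk (c ^ 2) (sq_nonneg _) * v) := by
  have h := Measure.pi_map_pi (μ := fun _ : Fin D => gaussianReal 0 v)
    (f := fun _ x => c * x) (fun _ => (measurable_const_mul c).aemeasurable)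
  simp only [gaussianReal_map_const_mul, mul_zero] at h
  exact h

theorem isoGaussian_conv (D : ℕ) (a b : ℝ≥0) :
    isoGaussian D a ∗ isoGaussian D b = isoGaussian D (a + b) := by
  have h1 := (measurePreserving_arrowProdEquivProdArrow ℝ ℝ (Fin D)
    (fun _ => gaussianReal 0 a) (fun _ => gaussianReal 0 b)).map_eq
  have h2 := Measure.pi_map_pi (μ := fun _ : Fin D => (gaussianReal 0 a).prod (gaussianReal 0 b))
    (f := fun _ x => x.1 + x.2) (fun _ => (measurable_fst.add measurable_snd).aemeasurable)
  have h3 : ((gaussianReal 0 a).prod (gaussianReal 0 b)).map (fun x => x.1 + x.2) =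
      gaussianReal 0 (a + b) := by
    have := gaussianReal_conv_gaussianReal (m₁ := 0) (m₂ := 0) (v₁ := a) (v₂ := b)
    rwa [zero_add] at this
  rw [h3] at h2
  rw [Measure.conv, isoGaussian, isoGaussian, ← h1, Measure.map_map (by fun_prop) (by fun_prop)]
  exact h2

theorem isoGaussian_zero (D : ℕ) : isoGaussian D 0 = Measure.dirac 0 := by
  have h := isoGaussian_map_smul (D := D) 0 1
  simpa [Measure.map_const] using h.symm

/-- The law of a linear combination of independent isotropic Gaussians. -/
theorem map_sum_smul {n D : ℕ} (v : ℝ≥0) (c : Fin n → ℝ) (s : Finset (Fin n)) :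
    (Measure.pi fun _ : Fin n => isoGaussian D v).map (fun g => ∑ j ∈ s, c j • g j) =
      isoGaussian D ((∑ j ∈ s, .mk (c j ^ 2) (sq_nonneg _)) * v) := by
  induction s using Finset.cons_induction with
  | empty => simp [Measure.map_const, isoGaussian_zero]
  | cons i s hi ih =>
    have hX : iIndepFun (fun j (g : Fin n → Fin D → ℝ) => c j • g j)
        (Measure.pi fun _ : Fin n => isoGaussian D v) :=
      iIndepFun_pi (X := fun j (x : Fin D → ℝ) => c j • x)
        fun j => (measurable_const_smul (c j)).aemeasurable
    have hm (j : Fin n) : Measurable fun g : Fin n → Fin D → ℝ => c j • g j := by fun_prop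
    have hind := (hX.indepFun_finsetSum_of_notMem hm hi).symm
    have hlaw : (Measure.pi fun _ : Fin n => isoGaussian D v).map (fun g => c i • g i) =
        isoGaussian D (.mk (c i ^ 2) (sq_nonneg _) * v) := by
      have h := Measure.map_map (μ := Measure.pi fun _ : Fin n => isoGaussian D v)
        (measurable_const_smul (c i) (α := Fin D → ℝ)) (measurable_pi_apply i)
      have he := (measurePreserving_eval (fun _ : Fin n => isoGaussian D v) i).map_eq
      exact h.symm.trans ((congrArg _ he).trans (isoGaussian_map_smul _ _))
    have hadd := hind.map_add_eq_map_conv_map (hm i) (by fun_prop)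
    have hfun : (fun g : Fin n → Fin D → ℝ => ∑ j ∈ Finset.cons i s hi, c j • g j) =
        (fun g => c i • g i) + ∑ j ∈ s, fun g => c j • g j := by
      ext g; simp [Finset.sum_insert hi]
    have hfun' : (∑ j ∈ s, fun g : Fin n → Fin D → ℝ => c j • g j) =
        fun g => ∑ j ∈ s, c j • g j := by
      ext g; simp
    rw [hfun, hadd, hfun', hlaw, ih, isoGaussian_conv, Finset.sum_cons, add_mul]

theorem lintegral_pi_prod {ι : Type*} [Fintype ι] {E : ι → Type*} [∀ i, MeasurableSpace (E i)]
    (μ : ∀ i, Measure (E i)) [∀ i, IsProbabilityMeasure (μ i)] (f : ∀ i, E i → ℝ≥0∞)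
    (hf : ∀ i, Measurable (f i)) :
    ∫⁻ x, ∏ i, f i (x i) ∂(Measure.pi μ) = ∏ i, ∫⁻ x, f i x ∂(μ i) := by
  have h := lintegral_prod_eq_prod_lintegral_of_indepFun Finset.univ
    (fun i (x : ∀ i, E i) => f i (x i))
    (iIndepFun_pi (μ := μ) (X := f) fun i => (hf i).aemeasurable)
    fun i => (hf i).comp (measurable_pi_apply i)
  rw [h]
  refine Finset.prod_congr rfl fun i _ => ?_
  rw [← (measurePreserving_eval μ i).lintegral_comp (hf i)]

theorem pi_withDensity {ι : Type*} [Fintype ι] {E : ι → Type*} [∀ i, MeasurableSpace (E i)]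
    (μ ν : ∀ i, Measure (E i)) [∀ i, IsProbabilityMeasure (μ i)] [∀ i, IsProbabilityMeasure (ν i)]
    (f : ∀ i, E i → ℝ≥0∞) (hf : ∀ i, Measurable (f i)) (h : ∀ i, μ i = (ν i).withDensity (f i)) :
    Measure.pi μ = (Measure.pi ν).withDensity fun x => ∏ i, f i (x i) := by
  refine Measure.pi_eq fun s hs => ?_
  rw [withDensity_apply _ (MeasurableSet.univ_pi hs), ← lintegral_indicator (.univ_pi hs)]
  have h1 (x : ∀ i, E i) : (Set.univ.pi s).indicator (fun x => ∏ i, f i (x i)) x =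
      ∏ i, (s i).indicator (f i) (x i) := by
    by_cases hx : ∀ i, x i ∈ s i
    · rw [Set.indicator_of_mem (by simpa using hx)]
      exact Finset.prod_congr rfl fun i _ => (Set.indicator_of_mem (hx i) _).symm
    · rw [Set.indicator_of_notMem (by simpa using hx)]
      push Not at hx
      obtain ⟨i, hi⟩ := hx
      exact (Finset.prod_eq_zero (Finset.mem_univ i) (Set.indicator_of_notMem hi _)).symm
  simp_rw [h1]
  rw [lintegral_pi_prod ν _ fun i => (hf i).indicator (hs i)]
  refine Finset.prod_congr rfl fun i _ => ?_
  rw [lintegral_indicator (hs i), h i, withDensity_apply _ (hs i)]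

/-- The logarithm of the density of `N(a, v)` with respect to `N(b, w)`. -/
noncomputable def gaussianLLR (a b : ℝ) (v w : ℝ≥0) (x : ℝ) : ℝ :=
  (Real.log w - Real.log v) / 2 - (x - a) ^ 2 / (2 * v) + (x - b) ^ 2 / (2 * w)

theorem measurable_gaussianLLR (a b : ℝ) (v w : ℝ≥0) : Measurable (gaussianLLR a b v w) := by
  unfold gaussianLLR; fun_prop

theorem gaussianReal_eq_withDensity (a b : ℝ) {v w : ℝ≥0} (hv : v ≠ 0) (hw : w ≠ 0) :
    gaussianReal a v = (gaussianReal b w).withDensity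
      fun x => ENNReal.ofReal (Real.exp (gaussianLLR a b v w x)) := by
  have hv' : (0 : ℝ) < v := by positivity
  have hw' : (0 : ℝ) < w := by positivity
  rw [gaussianReal_of_var_ne_zero a hv, gaussianReal_of_var_ne_zero b hw,
    ← withDensity_mul _ (measurable_gaussianPDF b w)
      (measurable_gaussianLLR a b v w).exp.ennreal_ofReal]
  congr 1
  ext1 x
  rw [Pi.mul_apply, gaussianPDF, gaussianPDF, ← ENNReal.ofReal_mul (gaussianPDFReal_nonneg _ _ _),
    gaussianPDFReal, gaussianPDFReal]
  have hs (r : ℝ) (hr : 0 < r) :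
      (Real.sqrt (2 * Real.pi * r))⁻¹ =
        Real.exp (-(Real.log (2 * Real.pi) + Real.log r) / 2) := by
    rw [← Real.log_mul (by positivity) hr.ne', neg_div, Real.exp_neg, Real.exp_half,
      Real.exp_log (by positivity)]
  rw [hs v hv', hs w hw', ← Real.exp_add, ← Real.exp_add, ← Real.exp_add, gaussianLLR]
  congr 2
  ring

theorem shiftedGaussian_eq_withDensity {D : ℕ} (a b : Fin D → ℝ) {v w : ℝ≥0} (hv : v ≠ 0)
    (hw : w ≠ 0) :
    shiftedGaussian a v = (shiftedGaussian b w).withDensity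
      fun x => ENNReal.ofReal (Real.exp (∑ d, gaussianLLR (a d) (b d) v w (x d))) := by
  rw [shiftedGaussian, shiftedGaussian, pi_withDensity _ _
    (fun d x => ENNReal.ofReal (Real.exp (gaussianLLR (a d) (b d) v w x)))
    (fun d => (measurable_gaussianLLR _ _ v w).exp.ennreal_ofReal)
    fun d => gaussianReal_eq_withDensity (a d) (b d) hv hw]
  congr 1
  ext1 x
  rw [Real.exp_sum, ENNReal.ofReal_prod_of_nonneg fun _ _ => (Real.exp_pos _).le]

/-- Tilting a Gaussian by a log density of another Gaussian leaves total mass one. -/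
theorem lintegral_exp_gaussianLLR {D : ℕ} (a b : Fin D → ℝ) {v w : ℝ≥0} (hv : v ≠ 0)
    (hw : w ≠ 0) :
    ∫⁻ x, ENNReal.ofReal (Real.exp (∑ d, gaussianLLR (a d) (b d) v w (x d)))
      ∂(shiftedGaussian b w) = 1 := by
  rw [← setLIntegral_univ, ← withDensity_apply _ .univ, ← shiftedGaussian_eq_withDensity a b hv hw,
    measure_univ]

theorem klDiv_withDensity_exp {X : Type*} [MeasurableSpace X] (μ ν : Measure X)
    [IsProbabilityMeasure μ] [IsProbabilityMeasure ν] (f : X → ℝ) (hf : Measurable f)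
    (h : μ = ν.withDensity fun x => ENNReal.ofReal (Real.exp (f x))) (hi : Integrable f μ) :
    klDiv μ ν = ENNReal.ofReal (∫ x, f x ∂μ) := by
  have hac : μ ≪ ν := h ▸ withDensity_absolutelyContinuous _ _
  have hr : llr μ ν =ᵐ[μ] f := by
    have h1 : μ.rnDeriv ν =ᵐ[ν] fun x => ENNReal.ofReal (Real.exp (f x)) := by
      conv_lhs => rw [h]
      exact Measure.rnDeriv_withDensity _ hf.exp.ennreal_ofReal
    filter_upwards [hac.ae_le h1] with x hx
    rw [llr, hx, ENNReal.toReal_ofReal (Real.exp_pos _).le, Real.log_exp]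
  rw [klDiv_of_ac_of_integrable hac (hi.congr hr.symm), integral_congr_ae hr]
  simp

theorem integrable_sq_sub_gaussianReal (a b : ℝ) (v : ℝ≥0) :
    Integrable (fun x => (x - b) ^ 2) (gaussianReal a v) :=
  ((memLp_id_gaussianReal 2).sub (memLp_const b)).integrable_sq

theorem integral_sq_sub_gaussianReal (a b : ℝ) (v : ℝ≥0) :
    ∫ x, (x - b) ^ 2 ∂(gaussianReal a v) = v + (a - b) ^ 2 := by
  have h1 : MemLp (fun x : ℝ => x - b) 2 (gaussianReal a v) :=
    (memLp_id_gaussianReal 2).sub (memLp_const b)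
  have h2 : Var[fun x => x - b; gaussianReal a v] = v := by
    rw [variance_sub_const (X := fun x => x) aestronglyMeasurable_id, variance_fun_id_gaussianReal]
  have h3 : ∫ x, (x - b) ∂(gaussianReal a v) = a - b := by
    have hid : Integrable (fun x : ℝ => x) (gaussianReal a v) :=
      (memLp_id_gaussianReal 1).integrable le_rfl
    rw [integral_sub hid (integrable_const b)]
    simp
  rw [variance_eq_sub h1, h3] at h2
  have h4 : ∫ x, (x - b) ^ 2 ∂(gaussianReal a v) = (gaussianReal a v)[(fun x => x - b) ^ 2] := rfl
  rw [h4]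
  linarith

theorem integrable_gaussianLLR (a b : ℝ) (v w : ℝ≥0) :
    Integrable (gaussianLLR a b v w) (gaussianReal a v) :=
  ((integrable_const _).sub ((integrable_sq_sub_gaussianReal a a v).div_const _)).add
    ((integrable_sq_sub_gaussianReal a b v).div_const _)

theorem integral_gaussianLLR (a b : ℝ) {v w : ℝ≥0} (hv : v ≠ 0) :
    ∫ x, gaussianLLR a b v w x ∂(gaussianReal a v) =
      (Real.log w - Real.log v + v / w - 1) / 2 + (a - b) ^ 2 / (2 * w) := by
  have h1 := (integrable_sq_sub_gaussianReal a a v).div_const (2 * v)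
  have h2 := (integrable_sq_sub_gaussianReal a b v).div_const (2 * w)
  have h0 : Integrable (fun _ : ℝ => (Real.log w - Real.log v) / 2) (gaussianReal a v) :=
    integrable_const _
  unfold gaussianLLR
  have h01 : Integrable (fun x => (Real.log w - Real.log v) / 2 - (x - a) ^ 2 / (2 * v))
      (gaussianReal a v) := h0.sub h1
  rw [integral_add h01 h2, integral_sub h0 h1, integral_div (2 * (v : ℝ)),
    integral_div (2 * (w : ℝ)),
    integral_sq_sub_gaussianReal, integral_sq_sub_gaussianReal]
  have : (v : ℝ) ≠ 0 := by exact_mod_cast hv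
  simp
  field_simp
  ring

/-- The divergence between isotropic Gaussians. -/
theorem klDiv_shiftedGaussian {D : ℕ} (a b : Fin D → ℝ) {v w : ℝ≥0} (hv : v ≠ 0) (hw : w ≠ 0) :
    klDiv (shiftedGaussian a v) (shiftedGaussian b w) =
      ENNReal.ofReal (D * ((Real.log w - Real.log v + v / w - 1) / 2) +
        ∑ d, (a d - b d) ^ 2 / (2 * w)) := by
  have hint (d : Fin D) : Integrable (fun x : Fin D → ℝ => gaussianLLR (a d) (b d) v w (x d))
      (shiftedGaussian a v) :=
    integrable_comp_eval (μ := fun d => gaussianReal (a d) v) (integrable_gaussianLLR _ _ v w)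
  rw [klDiv_withDensity_exp _ _ _ _ (shiftedGaussian_eq_withDensity a b hv hw)
    (integrable_finsetSum _ fun d _ => hint d)]
  · congr 1
    rw [integral_finsetSum _ fun d _ => hint d]
    have h (d : Fin D) : ∫ x, gaussianLLR (a d) (b d) v w (x d) ∂(shiftedGaussian a v) =
        (Real.log w - Real.log v + v / w - 1) / 2 + (a d - b d) ^ 2 / (2 * w) := by
      rw [← integral_gaussianLLR _ _ hv]
      exact integral_comp_eval (μ := fun d => gaussianReal (a d) v)
        (measurable_gaussianLLR _ _ v w).aestronglyMeasurable
    simp_rw [h]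
    rw [Finset.sum_add_distrib]
    simp
  · exact Finset.measurable_sum _ fun d _ =>
      (measurable_gaussianLLR _ _ v w).comp (measurable_pi_apply d)

/-! ### The law of the sample and of the final weights -/

instance discreteMeasurableSpace_intUnits : DiscreteMeasurableSpace ℤˣ := by
  refine ⟨fun s => ⟨Units.val '' s, .of_discrete, ?_⟩⟩
  exact Set.preimage_image_eq _ Units.val_injective

/-- The noise component `y x₂` of an example after its label has been absorbed. -/
noncomputable def latentNoise {K D : ℕ} (z : Example K D) : Fin D → ℝ :=
  ((z.1 : ℤ) : ℝ) • z.2.2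

theorem measurable_latentNoise {K D : ℕ} : Measurable (latentNoise : Example K D → Fin D → ℝ) :=
  (measurable_label.comp measurable_fst).smul measurable_snd.snd

theorem measurable_exampleMap {K : ℕ} (D : ℕ) (u : Fin K → ℝ) :
    Measurable fun p : ℤˣ × (Fin D → ℝ) => ((p.1, (((p.1 : ℤ) : ℝ) • u, p.2)) : Example K D) :=
  measurable_fst.prodMk (((measurable_label.comp measurable_fst).smul_const u).prodMk
    measurable_snd)

theorem exampleLaw_map_latentNoise {K : ℕ} (D : ℕ) (u : Fin K → ℝ) (σ : ℝ≥0) :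
    (exampleLaw D u σ).map latentNoise = isoGaussian D (σ ^ 2 / D) := by
  rw [exampleLaw, Measure.map_map measurable_latentNoise (measurable_exampleMap D u)]
  set γ := isoGaussian D (σ ^ 2 / D)
  have hm : Measurable (latentNoise ∘ fun p : ℤˣ × (Fin D → ℝ) =>
      ((p.1, (((p.1 : ℤ) : ℝ) • u, p.2)) : Example K D)) :=
    measurable_latentNoise.comp (measurable_exampleMap D u)
  have h1 (y : ℤˣ) : γ.map ((latentNoise ∘ fun p : ℤˣ × (Fin D → ℝ) =>
      ((p.1, (((p.1 : ℤ) : ℝ) • u, p.2)) : Example K D)) ∘ Prod.mk y) = γ := by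
    have h2 := isoGaussian_map_smul (D := D) ((y : ℤ) : ℝ) (σ ^ 2 / D)
    have h3 : (NNReal.mk (((y : ℤ) : ℝ) ^ 2) (sq_nonneg _)) = 1 := by
      rcases Int.units_eq_one_or y with rfl | rfl <;> ext <;> simp
    rw [h3, one_mul] at h2
    exact h2
  rw [labelLaw, Measure.prod_smul_left, Measure.add_prod, Measure.dirac_prod, Measure.dirac_prod,
    Measure.map_smul, Measure.map_add _ _ hm, Measure.map_map hm (by fun_prop),
    Measure.map_map hm (by fun_prop), h1, h1, ← two_smul ℝ≥0∞ γ, smul_smul,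
    ENNReal.inv_mul_cancel (by simp) (by simp), one_smul]

theorem ae_exampleLaw_signal {K : ℕ} (D : ℕ) (u : Fin K → ℝ) (σ : ℝ≥0) :
    ∀ᵐ z ∂(exampleLaw D u σ), z.2.1 = ((z.1 : ℤ) : ℝ) • u := by
  rw [exampleLaw, ae_map_iff (measurable_exampleMap D u).aemeasurable]
  · exact ae_of_all _ fun p => rfl
  · exact measurableSet_eq_fun measurable_snd.fst
      ((measurable_label.comp measurable_fst).smul_const u)

/-- The law of the sample. -/
noncomputable abbrev sampleLaw (n : ℕ) {K : ℕ} (D : ℕ) (u : Fin K → ℝ) (σ : ℝ≥0) :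
    Measure (Fin n → Example K D) :=
  Measure.pi fun _ => exampleLaw D u σ

theorem ae_sampleLaw_signal {n K : ℕ} (D : ℕ) (u : Fin K → ℝ) (σ : ℝ≥0) :
    ∀ᵐ s ∂(sampleLaw n D u σ), ∀ i, (s i).2.1 = (((s i).1 : ℤ) : ℝ) • u := by
  rw [ae_all_iff]
  intro i
  exact (Measure.quasiMeasurePreserving_eval (fun _ : Fin n => exampleLaw D u σ) i).ae
    (ae_exampleLaw_signal D u σ)

/-- The part of the noise component of the final weights contributed by the data in `T`. The datum
with index `i`, counted from zero, has step size `1 / (i + 1)`. -/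
noncomputable def partialNoise {n K D : ℕ} (T : Finset (Fin n)) (s : Fin n → Example K D) :
    Fin D → ℝ :=
  ∑ i ∈ T, (1 / ((i : ℝ) + 1)) • latentNoise (s i)

theorem measurable_partialNoise {n K D : ℕ} (T : Finset (Fin n)) :
    Measurable (partialNoise T : (Fin n → Example K D) → Fin D → ℝ) :=
  Finset.measurable_fun_sum _ fun i _ =>
    (measurable_const_smul (1 / ((i : ℝ) + 1))).comp
      (measurable_latentNoise.comp (measurable_pi_apply i))

theorem sgdIterate_eq_sum {n K D : ℕ} (s : Fin n → Example K D) :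
    sgdIterate s n = ∑ i : Fin n, (1 / ((i : ℝ) + 1)) • ((((s i).1 : ℤ) : ℝ) • (s i).2) := by
  have h (t : ℕ) (ht : t ≤ n) : sgdIterate s t = ∑ j ∈ Finset.range t,
      if h : j < n then (1 / ((j : ℝ) + 1)) • ((((s ⟨j, h⟩).1 : ℤ) : ℝ) • (s ⟨j, h⟩).2)
        else 0 := by
    induction t with
    | zero => rfl
    | succ t ih =>
      rw [sgdIterate, Finset.sum_range_succ, ← ih (by omega), dif_pos (by omega),
        dif_pos (by omega)]
  rw [h n le_rfl, Finset.sum_range]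
  exact Finset.sum_congr rfl fun i _ => dif_pos i.2

theorem sgdIterate_snd {n K D : ℕ} (s : Fin n → Example K D) :
    (sgdIterate s n).2 = partialNoise Finset.univ s := by
  rw [sgdIterate_eq_sum, Prod.snd_sum]
  rfl

theorem sgdIterate_fst {n K D : ℕ} (u : Fin K → ℝ) (s : Fin n → Example K D)
    (hs : ∀ i, (s i).2.1 = (((s i).1 : ℤ) : ℝ) • u) :
    (sgdIterate s n).1 = (∑ i : Fin n, 1 / ((i : ℝ) + 1)) • u := by
  rw [sgdIterate_eq_sum, Prod.fst_sum, Finset.sum_smul]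
  refine Finset.sum_congr rfl fun i _ => ?_
  rw [Prod.smul_fst, Prod.smul_fst, hs i]
  rcases Int.units_eq_one_or (s i).1 with h | h <;> simp [h]

/-- The posterior is a Gaussian in the noise component with a fixed signal component. -/
theorem sgdPosterior_apply {n K D : ℕ} (κ : ℝ≥0) (s : Fin n → Example K D) :
    sgdPosterior n K D κ s =
      (shiftedGaussian (partialNoise Finset.univ s) κ).map (Prod.mk (sgdIterate s n).1) := by
  rw [sgdPosterior, Kernel.map_apply _ measurable_finalWeights, Kernel.prod_apply,
    Kernel.id_apply, Kernel.const_apply, Measure.dirac_prod,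
    Measure.map_map measurable_finalWeights (by fun_prop), ← isoGaussian_map_add,
    Measure.map_map (by fun_prop) (by fun_prop)]
  congr 1
  ext1 x
  simp only [Function.comp_apply, finalWeights]
  rw [← sgdIterate_snd]
  ext <;> simp

/-- The sum `∑ η_i²` of the squared step sizes of the data in `T`. -/
noncomputable def stepSq {n : ℕ} (T : Finset (Fin n)) : ℝ≥0 :=
  ∑ i ∈ T, .mk ((1 / ((i : ℝ) + 1)) ^ 2) (sq_nonneg _)

theorem sampleLaw_map_partialNoise {n K : ℕ} (D : ℕ) (u : Fin K → ℝ) (σ : ℝ≥0)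
    (T : Finset (Fin n)) :
    (sampleLaw n D u σ).map (partialNoise T) = isoGaussian D (stepSq T * (σ ^ 2 / D)) := by
  have h := Measure.pi_map_pi (μ := fun _ : Fin n => exampleLaw D u σ)
    (f := fun _ => latentNoise) (fun _ => measurable_latentNoise.aemeasurable)
    (hμ := fun _ => by rw [exampleLaw_map_latentNoise]; infer_instance)
  rw [stepSq, ← map_sum_smul]
  simp_rw [exampleLaw_map_latentNoise] at h
  have hm : Measurable fun (x : Fin n → Example K D) i => latentNoise (x i) :=
    measurable_pi_lambda _ fun i => measurable_latentNoise.comp (measurable_pi_apply i)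
  rw [← h, Measure.map_map (by fun_prop) hm]
  rfl

theorem map_partialNoise_add {n K : ℕ} (D : ℕ) (u : Fin K → ℝ) (σ κ : ℝ≥0)
    (T : Finset (Fin n)) :
    ((sampleLaw n D u σ).prod (isoGaussian D κ)).map (fun p => partialNoise T p.1 + p.2) =
      isoGaussian D (stepSq T * (σ ^ 2 / D) + κ) := by
  have h := Measure.map_prod_map (sampleLaw n D u σ) (isoGaussian D κ)
    (measurable_partialNoise T) measurable_id
  rw [← isoGaussian_conv, ← sampleLaw_map_partialNoise D u, Measure.conv]
  nth_rw 2 [← Measure.map_id (μ := isoGaussian D κ)]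
  rw [h, Measure.map_map (by fun_prop) ((measurable_partialNoise T).prodMap measurable_id)]
  rfl

/-- Replacing the data in `J` by independent copies does not change the law of the sample. -/
theorem sampleLaw_overwrite {n K : ℕ} (D : ℕ) (u : Fin K → ℝ) (σ : ℝ≥0) (J : Finset (Fin n)) :
    MeasurePreserving (overwrite J)
      ((Measure.pi fun _ : J => exampleLaw D u σ).prod (sampleLaw n D u σ))
      (sampleLaw n D u σ) := by
  classical
  refine ⟨measurable_overwrite J, (Measure.pi_eq fun t ht => ?_).symm⟩
  have hpre : overwrite J ⁻¹' (Set.univ.pi t) =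
      (Set.univ.pi fun i : J => t i) ×ˢ (Set.univ.pi fun i => if i ∈ J then Set.univ else t i) := by
    ext p
    simp only [Set.mem_preimage, Set.mem_pi, Set.mem_univ, true_imp_iff, Set.mem_prod, overwrite]
    constructor
    · refine fun h => ⟨fun i => by simpa using h i, fun i => ?_⟩
      have := h i
      split_ifs at this ⊢ with hi
      · trivial
      · exact this
    · rintro ⟨h1, h2⟩ i
      have := h2 i
      split_ifs at this ⊢ with hi
      · exact h1 ⟨i, hi⟩
      · exact this
  rw [Measure.map_apply (measurable_overwrite J) (.univ_pi ht), hpre, Measure.prod_prod,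
    Measure.pi_pi, Measure.pi_pi, ← Finset.prod_mul_prod_compl J fun i => exampleLaw D u σ (t i),
    Finset.prod_coe_sort J fun i => exampleLaw D u σ (t i),
    ← Finset.prod_mul_prod_compl J fun i => exampleLaw D u σ (if i ∈ J then Set.univ else t i)]
  have h1 : ∏ i ∈ J, exampleLaw D u σ (if i ∈ J then Set.univ else t i) = 1 :=
    Finset.prod_eq_one fun i hi => by simp [hi]
  rw [h1, one_mul]
  congr 1
  exact Finset.prod_congr rfl fun i hi => by rw [if_neg (Finset.mem_compl.1 hi)]

theorem restrict_overwrite {n K D : ℕ} (J : Finset (Fin n))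
    (p : (J → Example K D) × (Fin n → Example K D)) : (fun i : J => overwrite J p i) = p.1 := by
  ext1 i
  simp [overwrite]

/-- Integration over the sample by first fixing the data in `J`. -/
theorem lintegral_sampleLaw_overwrite {n K D : ℕ} (u : Fin K → ℝ) (σ : ℝ≥0) (J : Finset (Fin n))
    {f : (Fin n → Example K D) → ℝ≥0∞} (hf : Measurable f) :
    ∫⁻ s, f s ∂(sampleLaw n D u σ) =
      ∫⁻ z, ∫⁻ s, f (overwrite J (z, s)) ∂(sampleLaw n D u σ)
        ∂(Measure.pi fun _ : J => exampleLaw D u σ) := by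
  rw [← (sampleLaw_overwrite D u σ J).lintegral_comp hf,
    lintegral_prod (fun p => f (overwrite J p))
      (hf.comp (measurable_overwrite J)).aemeasurable]

/-! ### Expected divergence of the posterior from a prior -/

instance standardBorelSpace_example (K D : ℕ) : StandardBorelSpace (Example K D) := inferInstance

instance standardBorelSpace_sample (n K D : ℕ) : StandardBorelSpace (Fin n → Example K D) :=
  StandardBorelSpace.pi_countable (α := fun _ => Example K D)

/-- Given `S_J = z`, the oracle prior is the average of the posterior over the other data. -/
theorem oraclePrior_apply {n K D : ℕ} (u : Fin K → ℝ) (σ κ : ℝ≥0) (J : Finset (Fin n))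
    (z : J → Example K D) :
    oraclePrior u σ κ J z =
      (sgdPosterior n K D κ).comap (fun s => overwrite J (z, s))
        ((measurable_overwrite J).comp measurable_prodMk_left) ∘ₘ sampleLaw n D u σ := by
  have hm : Measurable fun s : Fin n → Example K D => overwrite J (z, s) :=
    (measurable_overwrite J).comp measurable_prodMk_left
  ext t ht
  rw [oraclePrior, Kernel.comp_apply, Kernel.map_apply _ (measurable_overwrite J),
    Kernel.prod_apply, Kernel.id_apply, Kernel.const_apply, Measure.dirac_prod,
    Measure.map_map (measurable_overwrite J) (by fun_prop),
    Measure.bind_apply ht (Kernel.aemeasurable _), Measure.bind_apply ht (Kernel.aemeasurable _)]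
  exact lintegral_map (Kernel.measurable_coe _ ht) hm

theorem measurable_restrict_sample {n K D : ℕ} (J : Finset (Fin n)) :
    Measurable fun (s : Fin n → Example K D) (i : J) => s i :=
  measurable_pi_lambda _ fun _ => measurable_pi_apply _

theorem measurable_klDiv_sgdPosterior {n K D : ℕ} (κ : ℝ≥0) (J : Finset (Fin n))
    (P : Kernel (J → Example K D) (Vec K D)) [IsMarkovKernel P] :
    Measurable fun s => klDiv (sgdPosterior n K D κ s) (P fun i => s i) :=
  measurable_klDiv_kernel (sgdPosterior n K D κ) (P.comap _ (measurable_restrict_sample J))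

/-- The oracle prior given `S_J` minimises the expected divergence among all priors that depend on
`S_J` only. -/
theorem lintegral_klDiv_oraclePrior_le {n K D : ℕ} (u : Fin K → ℝ) (σ κ : ℝ≥0)
    (J : Finset (Fin n)) (P : Kernel (J → Example K D) (Vec K D)) [IsMarkovKernel P] :
    ∫⁻ s, klDiv (sgdPosterior n K D κ s) (oraclePrior u σ κ J fun i => s i)
        ∂(sampleLaw n D u σ) ≤
      ∫⁻ s, klDiv (sgdPosterior n K D κ s) (P fun i => s i) ∂(sampleLaw n D u σ) := by
  rw [lintegral_sampleLaw_overwrite u σ J (measurable_klDiv_sgdPosterior κ J _),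
    lintegral_sampleLaw_overwrite u σ J (measurable_klDiv_sgdPosterior κ J _)]
  refine lintegral_mono fun z => ?_
  simp_rw [restrict_overwrite, oraclePrior_apply]
  exact lintegral_klDiv_comp_le (sampleLaw n D u σ)
    ((sgdPosterior n K D κ).comap (fun s => overwrite J (z, s))
      ((measurable_overwrite J).comp measurable_prodMk_left)) (P z)

theorem lintegral_sq_isoGaussian (D : ℕ) (v w : ℝ≥0) :
    ∫⁻ x, ENNReal.ofReal (∑ d, x d ^ 2 / (2 * w)) ∂(isoGaussian D v) =
      ENNReal.ofReal (D * (v / (2 * w))) := by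
  have h1 : Integrable (fun x : ℝ => x ^ 2 / (2 * w)) (gaussianReal 0 v) := by
    simpa using (integrable_sq_sub_gaussianReal 0 0 v).div_const (2 * w)
  have h2 (d : Fin D) : Integrable (fun x : Fin D → ℝ => x d ^ 2 / (2 * w)) (isoGaussian D v) :=
    integrable_comp_eval (μ := fun _ : Fin D => gaussianReal 0 v) h1
  have h3 (d : Fin D) : ∫ x, x d ^ 2 / (2 * (w : ℝ)) ∂(isoGaussian D v) = (v : ℝ) / (2 * w) := by
    have h := integral_comp_eval (μ := fun _ : Fin D => gaussianReal 0 v) (i := d)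
      h1.aestronglyMeasurable
    refine h.trans ?_
    rw [integral_div]
    simpa using congrArg (· / (2 * (w : ℝ))) (integral_sq_sub_gaussianReal 0 0 v)
  rw [← ofReal_integral_eq_lintegral_ofReal (integrable_finsetSum _ fun d _ => h2 d)
    (ae_of_all _ fun x => by positivity), integral_finsetSum _ fun d _ => h2 d]
  simp [h3]

/-- No prior that is independent of the data has a smaller expected divergence than the mutual
information of the sample and the final weights, which is that of the Gaussian channel
`m ↦ N(m, κ I)` with a Gaussian input. -/
theorem le_lintegral_klDiv_sgdPosterior {n K D : ℕ} (u : Fin K → ℝ) (σ : ℝ≥0) {κ : ℝ≥0}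
    (hκ : κ ≠ 0) (p : Measure (Vec K D)) [IsProbabilityMeasure p] :
    ENNReal.ofReal (D / 2 * Real.log (1 + stepSq (Finset.univ : Finset (Fin n)) * (σ ^ 2 / D) / κ))
      ≤ ∫⁻ s, klDiv (sgdPosterior n K D κ s) p ∂(sampleLaw n D u σ) := by
  set τ : ℝ≥0 := stepSq (Finset.univ : Finset (Fin n)) * (σ ^ 2 / D) with hτ
  have : IsProbabilityMeasure (p.map Prod.snd) :=
    Measure.isProbabilityMeasure_map measurable_snd.aemeasurable
  set R : Kernel (Fin n → Example K D) (Fin D → ℝ) := (sgdPosterior n K D κ).map Prod.snd with hR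
  have : IsMarkovKernel R := Kernel.IsMarkovKernel.map _ measurable_snd
  have hRs (s : Fin n → Example K D) : R s = shiftedGaussian (partialNoise Finset.univ s) κ := by
    rw [hR, Kernel.map_apply _ measurable_snd, sgdPosterior_apply,
      Measure.map_map measurable_snd (by fun_prop)]
    exact Measure.map_id
  have hmix : R ∘ₘ sampleLaw n D u σ = shiftedGaussian 0 (τ + κ) := by
    rw [shiftedGaussian_zero, hτ, ← map_partialNoise_add D u]
    ext t ht
    have hm : Measurable fun p : (Fin n → Example K D) × (Fin D → ℝ) =>
        partialNoise Finset.univ p.1 + p.2 :=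
      ((measurable_partialNoise _).comp measurable_fst).add measurable_snd
    rw [Measure.bind_apply ht (Kernel.aemeasurable _), Measure.map_apply hm ht,
      Measure.prod_apply (hm ht)]
    refine lintegral_congr fun s => ?_
    rw [hRs, ← isoGaussian_map_add, Measure.map_apply (by fun_prop) ht]
    rfl
  have hκ' : (0 : ℝ) < κ := by positivity
  have hτκ : (0 : ℝ) < τ + κ := by positivity
  -- the divergence between the centred Gaussians of variances `κ` and `τ + κ`
  have hpos : 0 ≤ (D : ℝ) * ((Real.log (τ + κ) - Real.log κ + κ / (τ + κ) - 1) / 2) := by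
    have h := Real.log_le_sub_one_of_pos (div_pos hκ' hτκ)
    rw [Real.log_div hκ'.ne' hτκ.ne'] at h
    have : 0 ≤ Real.log (τ + κ) - Real.log κ + κ / (τ + κ) - 1 := by linarith
    positivity
  calc _ = ENNReal.ofReal (D * ((Real.log (τ + κ) - Real.log κ + κ / (τ + κ) - 1) / 2)) +
        ENNReal.ofReal (D * (τ / (2 * (τ + κ)))) := by
        rw [← ENNReal.ofReal_add hpos (by positivity)]
        congr 1
        have h1 : 1 + (τ : ℝ) / κ = (τ + κ) / κ := by field_simp; ring
        have h2 : (τ : ℝ) / (2 * (τ + κ)) = (1 - κ / (τ + κ)) / 2 := by field_simp; ring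
        have h3 : (1 : ℝ) + stepSq (Finset.univ : Finset (Fin n)) * (σ ^ 2 / D) / κ =
            1 + (τ : ℝ) / κ := by rw [hτ]; push_cast; rfl
        rw [h3, h1, Real.log_div hτκ.ne' hκ'.ne', h2]
        ring
    _ = ∫⁻ s, klDiv (R s) (R ∘ₘ sampleLaw n D u σ) ∂(sampleLaw n D u σ) := by
        simp_rw [hmix, hRs]
        have hk (s : Fin n → Example K D) := klDiv_shiftedGaussian (v := κ) (w := τ + κ)
          (partialNoise Finset.univ s) 0 hκ (by positivity)
        simp_rw [hk]
        push_cast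
        simp_rw [fun s : Fin n → Example K D => ENNReal.ofReal_add hpos
          (show 0 ≤ ∑ d, (partialNoise Finset.univ s d - (0 : Fin D → ℝ) d) ^ 2 /
            (2 * ((τ : ℝ) + κ)) by positivity)]
        rw [lintegral_add_left measurable_const, lintegral_const, measure_univ, mul_one]
        congr 1
        have h := lintegral_sq_isoGaussian D τ (τ + κ)
        rw [hτ, ← sampleLaw_map_partialNoise D u, lintegral_map (by fun_prop)
          (measurable_partialNoise _), ← hτ] at h
        simpa using h.symm
    _ ≤ ∫⁻ s, klDiv (R s) (p.map Prod.snd) ∂(sampleLaw n D u σ) := lintegral_klDiv_comp_le _ _ _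
    _ ≤ _ := by
        -- discarding the signal component cannot increase the divergence
        refine lintegral_mono fun s => ?_
        rw [hR, Kernel.map_apply _ measurable_snd]
        exact klDiv_map_le _ _ measurable_snd

/-- The expected divergence from the oracle prior is at most that from the posterior of the sample
in which the data outside `J` are replaced by noiseless examples `(1, (u, 0))`. -/
theorem lintegral_klDiv_oraclePrior_le_sq {n K D : ℕ} (u : Fin K → ℝ) (σ : ℝ≥0) {κ : ℝ≥0}
    (hκ : κ ≠ 0) (J : Finset (Fin n)) :
    ∫⁻ s, klDiv (sgdPosterior n K D κ s) (oraclePrior u σ κ J fun i => s i)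
        ∂(sampleLaw n D u σ) ≤
      ENNReal.ofReal (D * (stepSq Jᶜ * (σ ^ 2 / D) / (2 * κ))) := by
  have hm : Measurable fun z : J → Example K D =>
      overwrite J (z, fun _ : Fin n => ((1, (u, 0)) : Example K D)) :=
    (measurable_overwrite J).comp measurable_prodMk_right
  refine (lintegral_klDiv_oraclePrior_le u σ κ J ((sgdPosterior n K D κ).comap _ hm)).trans ?_
  have hle : ∀ᵐ s ∂(sampleLaw n D u σ), klDiv (sgdPosterior n K D κ s)
      ((sgdPosterior n K D κ).comap _ hm fun i : J => s i) ≤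
        ENNReal.ofReal (∑ d, partialNoise Jᶜ s d ^ 2 / (2 * κ)) := by
    filter_upwards [ae_sampleLaw_signal D u σ] with s hs
    set s' := overwrite J ((fun i : J => s i), fun _ : Fin n => ((1, (u, 0)) : Example K D))
    have hs' (i : Fin n) : s' i = if i ∈ J then s i else (1, (u, 0)) := by
      simp [s', overwrite]
    have hs1 : ∀ i, (s' i).2.1 = (((s' i).1 : ℤ) : ℝ) • u := by
      intro i
      rw [hs' i]
      split_ifs
      · exact hs i
      · simp
    have hdiff : partialNoise Finset.univ s - partialNoise Finset.univ s' = partialNoise Jᶜ s := by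
      have h0 : partialNoise Jᶜ s' = 0 := Finset.sum_eq_zero fun i hi => by
        simp [hs', Finset.mem_compl.1 hi, latentNoise]
      have h1 : partialNoise J s' = partialNoise J s :=
        Finset.sum_congr rfl fun i hi => by rw [hs', if_pos hi]
      have h2 (r : Fin n → Example K D) : partialNoise Finset.univ r =
          partialNoise J r + partialNoise Jᶜ r := (Finset.sum_add_sum_compl J _).symm
      rw [h2, h2 s', h0, h1]
      abel
    rw [Kernel.comap_apply, sgdPosterior_apply, sgdPosterior_apply, sgdIterate_fst u s hs,
      sgdIterate_fst u s' hs1]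
    refine (klDiv_map_le _ _ (by fun_prop)).trans ?_
    rw [klDiv_shiftedGaussian _ _ hκ hκ, ← hdiff]
    have : (κ : ℝ) ≠ 0 := by exact_mod_cast hκ
    have hrhs :
        ∑ d, (partialNoise Finset.univ s - partialNoise Finset.univ s') d ^ 2 / (2 * (κ : ℝ)) =
        ∑ d, (partialNoise Finset.univ s d - partialNoise Finset.univ s' d) ^ 2 / (2 * (κ : ℝ)) :=
      rfl
    rw [hrhs, sub_self, div_self this]
    simp only [zero_add, sub_self, zero_div, mul_zero]
    exact le_rfl
  refine (lintegral_mono_ae hle).trans_eq ?_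
  have h := lintegral_sq_isoGaussian D (stepSq Jᶜ * (σ ^ 2 / D)) κ
  rw [← sampleLaw_map_partialNoise D u, lintegral_map (by fun_prop)
    (measurable_partialNoise _)] at h
  rw [h]
  push_cast
  rfl

/-! ### Exponential bound for the risk -/

/-- The Laplace transform of an isotropic Gaussian. -/
theorem lintegral_exp_dotProduct {D : ℕ} {w : ℝ≥0} (hw : w ≠ 0) (t : ℝ) (g : Fin D → ℝ) :
    ∫⁻ x, ENNReal.ofReal (Real.exp (t * (g ⬝ᵥ x))) ∂(isoGaussian D w) =
      ENNReal.ofReal (Real.exp (t ^ 2 * w / 2 * (g ⬝ᵥ g))) := by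
  have hw' : (w : ℝ) ≠ 0 := by exact_mod_cast hw
  have h := lintegral_exp_gaussianLLR (fun d => t * w * g d) (0 : Fin D → ℝ) hw hw
  rw [shiftedGaussian_zero] at h
  have hx (x : Fin D → ℝ) : ENNReal.ofReal (Real.exp (t * (g ⬝ᵥ x))) =
      ENNReal.ofReal (Real.exp (t ^ 2 * w / 2 * (g ⬝ᵥ g))) *
        ENNReal.ofReal
          (Real.exp (∑ d, gaussianLLR (t * w * g d) ((0 : Fin D → ℝ) d) w w (x d))) := by
    rw [← ENNReal.ofReal_mul (Real.exp_pos _).le, ← Real.exp_add]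
    congr 2
    simp only [dotProduct, Finset.mul_sum, ← Finset.sum_add_distrib]
    refine Finset.sum_congr rfl fun d _ => ?_
    rw [gaussianLLR, Pi.zero_apply]
    field_simp
    ring
  simp_rw [hx]
  rw [lintegral_const_mul' _ _ ENNReal.ofReal_ne_top, h, mul_one]

/-- The exponential moment of the squared norm of an isotropic Gaussian of variance `v`, bounded by
comparison with the Gaussian of variance `v'`. -/
theorem lintegral_exp_mul_sq_le {D : ℕ} {v v' : ℝ≥0} (hv : v ≠ 0) (hv' : v' ≠ 0) {θ : ℝ}
    (hθ : θ ≤ 1 / (2 * v) - 1 / (2 * v')) :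
    ∫⁻ x, ENNReal.ofReal (Real.exp (θ * (x ⬝ᵥ x))) ∂(isoGaussian D v) ≤
      ENNReal.ofReal (Real.exp (D * ((Real.log v' - Real.log v) / 2))) := by
  have h := lintegral_exp_gaussianLLR (0 : Fin D → ℝ) (0 : Fin D → ℝ) hv' hv
  rw [shiftedGaussian_zero] at h
  have hx (x : Fin D → ℝ) : ENNReal.ofReal (Real.exp (θ * (x ⬝ᵥ x))) ≤
      ENNReal.ofReal (Real.exp (D * ((Real.log v' - Real.log v) / 2))) *
        ENNReal.ofReal (Real.exp
          (∑ d, gaussianLLR ((0 : Fin D → ℝ) d) ((0 : Fin D → ℝ) d) v' v (x d))) := by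
    rw [← ENNReal.ofReal_mul (Real.exp_pos _).le, ← Real.exp_add]
    gcongr
    have h1 : θ * (x ⬝ᵥ x) ≤ (1 / (2 * v) - 1 / (2 * v')) * (x ⬝ᵥ x) :=
      mul_le_mul_of_nonneg_right hθ (Finset.sum_nonneg fun d _ => mul_self_nonneg _)
    refine h1.trans_eq ?_
    simp only [gaussianLLR, Pi.zero_apply, sub_zero, Finset.sum_add_distrib, Finset.sum_sub_distrib,
      Finset.sum_const, Finset.card_univ, Fintype.card_fin, nsmul_eq_mul, dotProduct,
      ← Finset.sum_div, ← pow_two]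
    ring
  refine (lintegral_mono hx).trans ?_
  rw [lintegral_const_mul' _ _ ENNReal.ofReal_ne_top, h, mul_one]

theorem loss_le_one {K D : ℕ} (w : Vec K D) (z : Example K D) : loss w z ≤ 1 := by
  unfold loss; split_ifs <;> simp

/-- The exponential surrogate of the zero-one loss: the margin `y ⟨x, w⟩` is the sum of the signal
`a |u|²` and the latent noise. -/
theorem loss_le_exp {K D : ℕ} (u : Fin K → ℝ) (z : Example K D)
    (hz : z.2.1 = ((z.1 : ℤ) : ℝ) • u) (a : ℝ) (b : Fin D → ℝ) {t : ℝ} (ht : 0 ≤ t) :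
    loss (a • u, b) z ≤
      ENNReal.ofReal (Real.exp (-t * (a * (u ⬝ᵥ u) + latentNoise z ⬝ᵥ b))) := by
  set r := a * (u ⬝ᵥ u) + latentNoise z ⬝ᵥ b with hr
  have hip : ip z.2 (a • u, b) = ((z.1 : ℤ) : ℝ) * r := by
    have h2 : ((z.1 : ℤ) : ℝ) * ((z.1 : ℤ) : ℝ) = 1 := by
      rcases Int.units_eq_one_or z.1 with h | h <;> simp [h]
    rw [ip, hz, hr, latentNoise]
    simp only [smul_dotProduct, dotProduct_smul, smul_eq_mul]
    linear_combination (-(z.2.2 ⬝ᵥ b)) * h2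
  by_cases h : 0 < r
  · have h0 : loss (a • u, b) z = 0 := by
      rw [loss, if_pos]
      rw [classify, hip]
      rcases Int.units_eq_one_or z.1 with hy | hy
      · simp [hy, Real.sign_of_pos h]
      · simp [hy, Real.sign_of_neg (neg_lt_zero.2 h)]
    rw [h0]
    exact zero_le
  · refine (loss_le_one _ _).trans ?_
    rw [← ENNReal.ofReal_one]
    refine ENNReal.ofReal_le_ofReal (Real.one_le_exp ?_)
    nlinarith

theorem stepSq_mono {n : ℕ} {S T : Finset (Fin n)} (h : S ⊆ T) : stepSq S ≤ stepSq T :=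
  Finset.sum_le_sum_of_subset h

/-- The exponential surrogate loss for the signal `r`, the latent noise `g` of the datum and the
noise component `b` of the weights. -/
noncomputable def expLoss {D : ℕ} (t r : ℝ) (g b : Fin D → ℝ) : ℝ≥0∞ :=
  ENNReal.ofReal (Real.exp (-t * (r + g ⬝ᵥ b)))

theorem measurable_expLoss {D : ℕ} (t r : ℝ) :
    Measurable fun p : (Fin D → ℝ) × (Fin D → ℝ) => expLoss t r p.1 p.2 := by
  simp only [expLoss, dotProduct]
  fun_prop

/-- The surrogate risk given the datum `i`. This datum influences the final weights only through a
nonnegative contribution to its own margin; the remaining noise is Gaussian and independent of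
it. -/
theorem lintegral_expLoss_overwrite_le {n K D : ℕ} (u : Fin K → ℝ) {σ κ : ℝ≥0} (hκ : κ ≠ 0)
    {t : ℝ} (ht : 0 ≤ t) (r : ℝ) (i : Fin n) (z : ({i} : Finset (Fin n)) → Example K D) :
    ∫⁻ s, ∫⁻ x, expLoss t r (latentNoise (overwrite {i} (z, s) i))
        (partialNoise Finset.univ (overwrite {i} (z, s)) + x) ∂(isoGaussian D κ)
        ∂(sampleLaw n D u σ) ≤
      ENNReal.ofReal (Real.exp (-t * r)) *
        ENNReal.ofReal (Real.exp
          (t ^ 2 * (stepSq ({i}ᶜ : Finset (Fin n)) * (σ ^ 2 / D) + κ : ℝ≥0) / 2 *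
          (latentNoise (z ⟨i, Finset.mem_singleton_self i⟩) ⬝ᵥ
            latentNoise (z ⟨i, Finset.mem_singleton_self i⟩)))) := by
  set g := latentNoise (z ⟨i, Finset.mem_singleton_self i⟩) with hg
  have hw0 : stepSq ({i}ᶜ : Finset (Fin n)) * (σ ^ 2 / D) + κ ≠ 0 :=
    (lt_of_lt_of_le (pos_iff_ne_zero.2 hκ) le_add_self).ne'
  have hi (s : Fin n → Example K D) :
      overwrite {i} (z, s) i = z ⟨i, Finset.mem_singleton_self i⟩ := by
    simp [overwrite]
  have hsum (s : Fin n → Example K D) : partialNoise Finset.univ (overwrite {i} (z, s)) =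
      (1 / ((i : ℝ) + 1)) • g + partialNoise {i}ᶜ s := by
    rw [partialNoise, ← Finset.sum_add_sum_compl {i}, Finset.sum_singleton, hi]
    congr 1
    refine Finset.sum_congr rfl fun j hj => ?_
    simp [overwrite, show j ≠ i by simpa using hj]
  have hgg : 0 ≤ g ⬝ᵥ g := Finset.sum_nonneg fun d _ => mul_self_nonneg _
  have hle (s : Fin n → Example K D) (x : Fin D → ℝ) :
      expLoss t r (latentNoise (overwrite {i} (z, s) i))
        (partialNoise Finset.univ (overwrite {i} (z, s)) + x) ≤
      ENNReal.ofReal (Real.exp (-t * r)) *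
        ENNReal.ofReal (Real.exp (-t * (g ⬝ᵥ (partialNoise {i}ᶜ s + x)))) := by
    rw [← ENNReal.ofReal_mul (Real.exp_pos _).le, ← Real.exp_add, hi, hsum]
    refine ENNReal.ofReal_le_ofReal (Real.exp_le_exp.2 ?_)
    rw [← hg, add_assoc, dotProduct_add, dotProduct_smul, smul_eq_mul]
    have : 0 ≤ t * (1 / ((i : ℝ) + 1) * (g ⬝ᵥ g)) := by positivity
    linarith
  have hm2 : Measurable fun b : Fin D → ℝ =>
      ENNReal.ofReal (Real.exp (-t * (g ⬝ᵥ b))) := by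
    simp only [dotProduct]; fun_prop
  have hm3 : Measurable fun p : (Fin n → Example K D) × (Fin D → ℝ) =>
      partialNoise {i}ᶜ p.1 + p.2 :=
    ((measurable_partialNoise {i}ᶜ).comp measurable_fst).add measurable_snd
  refine (lintegral_mono fun s => lintegral_mono fun x => hle s x).trans_eq ?_
  simp_rw [lintegral_const_mul' _ _ ENNReal.ofReal_ne_top]
  congr 1
  have h1 := lintegral_exp_dotProduct hw0 (-t) g
  rw [← map_partialNoise_add D u, lintegral_map hm2 hm3, neg_sq] at h1
  exact (lintegral_prod (fun p : (Fin n → Example K D) × (Fin D → ℝ) =>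
    ENNReal.ofReal (Real.exp (-t * (g ⬝ᵥ (partialNoise {i}ᶜ p.1 + p.2)))))
    (hm2.comp hm3).aemeasurable).symm.trans h1

/-- A Chernoff bound for the expected risk on a single datum, with free parameters `t` and `v'`. The
first factor comes from the signal, the second from the Gaussian noise. -/
theorem lintegral_loss_le {n K D : ℕ} (u : Fin K → ℝ) {σ κ v' : ℝ≥0} (hκ : κ ≠ 0)
    (hv : σ ^ 2 / D ≠ 0) (hv' : v' ≠ 0) {t : ℝ} (ht : 0 ≤ t)
    (hθ : t ^ 2 * (stepSq (Finset.univ : Finset (Fin n)) * (σ ^ 2 / D : ℝ≥0) + κ) / 2 ≤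
      1 / (2 * (σ ^ 2 / D : ℝ≥0)) - 1 / (2 * v')) (i : Fin n) :
    ∫⁻ s, ∫⁻ w, loss w (s i) ∂(sgdPosterior n K D κ s) ∂(sampleLaw n D u σ) ≤
      ENNReal.ofReal (Real.exp (-t * ((∑ j : Fin n, 1 / ((j : ℝ) + 1)) * (u ⬝ᵥ u)))) *
      ENNReal.ofReal (Real.exp (D * ((Real.log v' - Real.log (σ ^ 2 / D : ℝ≥0)) / 2))) := by
  generalize hr : (∑ j : Fin n, 1 / ((j : ℝ) + 1)) * (u ⬝ᵥ u) = r
  have hm : Measurable fun s : Fin n → Example K D =>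
      ∫⁻ x, expLoss t r (latentNoise (s i)) (partialNoise Finset.univ s + x)
        ∂(isoGaussian D κ) := by
    have h1 : Measurable fun p : (Fin n → Example K D) × (Fin D → ℝ) => latentNoise (p.1 i) :=
      measurable_latentNoise.comp ((measurable_pi_apply i).comp measurable_fst)
    have h2 : Measurable fun p : (Fin n → Example K D) × (Fin D → ℝ) =>
        partialNoise Finset.univ p.1 + p.2 :=
      ((measurable_partialNoise Finset.univ).comp measurable_fst).add measurable_snd
    exact ((measurable_expLoss t r).comp (h1.prodMk h2)).lintegral_prod_right'
  have hm4 (θ : ℝ) : Measurable fun x : Fin D → ℝ =>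
      ENNReal.ofReal (Real.exp (θ * (x ⬝ᵥ x))) := by
    simp only [dotProduct]; fun_prop
  calc _ ≤ ∫⁻ s, ∫⁻ x, expLoss t r (latentNoise (s i)) (partialNoise Finset.univ s + x)
          ∂(isoGaussian D κ) ∂(sampleLaw n D u σ) := by
        refine lintegral_mono_ae ?_
        filter_upwards [ae_sampleLaw_signal D u σ] with s hs
        rw [sgdPosterior_apply, sgdIterate_fst u s hs, ← isoGaussian_map_add,
          Measure.map_map (by fun_prop) (by fun_prop)]
        refine (lintegral_map_le _ _).trans (lintegral_mono fun x => ?_)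
        rw [← hr]
        exact loss_le_exp u (s i) (hs i) _ _ ht
    _ ≤ ∫⁻ z, ENNReal.ofReal (Real.exp (-t * r)) *
          ENNReal.ofReal (Real.exp
            (t ^ 2 * (stepSq ({i}ᶜ : Finset (Fin n)) * (σ ^ 2 / D) + κ : ℝ≥0) / 2 *
            (latentNoise (z ⟨i, Finset.mem_singleton_self i⟩) ⬝ᵥ
              latentNoise (z ⟨i, Finset.mem_singleton_self i⟩))))
          ∂(Measure.pi fun _ : ({i} : Finset (Fin n)) => exampleLaw D u σ) := by
        rw [lintegral_sampleLaw_overwrite u σ {i} hm]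
        exact lintegral_mono fun z => lintegral_expLoss_overwrite_le u hκ ht r i z
    _ = ENNReal.ofReal (Real.exp (-t * r)) *
          ∫⁻ x, ENNReal.ofReal (Real.exp
            (t ^ 2 * (stepSq ({i}ᶜ : Finset (Fin n)) * (σ ^ 2 / D) + κ : ℝ≥0) / 2 * (x ⬝ᵥ x)))
            ∂(isoGaussian D (σ ^ 2 / D)) := by
        rw [lintegral_const_mul' _ _ ENNReal.ofReal_ne_top]
        congr 1
        have h := (measurePreserving_eval (fun _ : ({i} : Finset (Fin n)) => exampleLaw D u σ)
            ⟨i, Finset.mem_singleton_self i⟩).lintegral_comp ((hm4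
              (t ^ 2 * (stepSq ({i}ᶜ : Finset (Fin n)) * (σ ^ 2 / D) + κ : ℝ≥0) / 2)).comp
                measurable_latentNoise)
        rw [← exampleLaw_map_latentNoise D u, lintegral_map (hm4 _) measurable_latentNoise]
        exact h
    _ ≤ _ := by
        gcongr
        refine lintegral_exp_mul_sq_le hv hv' (le_trans ?_ hθ)
        rw [NNReal.coe_add, NNReal.coe_mul]
        have := stepSq_mono (Finset.subset_univ ({i}ᶜ : Finset (Fin n)))
        gcongr

/-! ### Minimising the expected bound -/

theorem measurable_loss {K D : ℕ} :
    Measurable fun p : Vec K D × Example K D => loss p.1 p.2 := by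
  have hsign : Measurable Real.sign := by
    unfold Real.sign
    exact Measurable.ite measurableSet_Iio measurable_const
      (Measurable.ite measurableSet_Ioi measurable_const measurable_const)
  have hip : Measurable fun p : Vec K D × Example K D => ip p.2.2 p.1 := by
    simp only [ip, dotProduct]
    fun_prop
  exact Measurable.ite (measurableSet_eq_fun (hsign.comp hip)
    (measurable_label.comp measurable_snd.fst)) measurable_const measurable_const

theorem measurable_lintegral_loss {n K D : ℕ} (κ : ℝ≥0) (i : Fin n) :
    Measurable fun s : Fin n → Example K D => ∫⁻ w, loss w (s i) ∂(sgdPosterior n K D κ s) := by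
  have hi : Measurable fun p : (Fin n → Example K D) × Vec K D => p.1 i :=
    (measurable_pi_apply i).comp measurable_fst
  have h := Measurable.comp (g := fun p : Vec K D × Example K D => loss p.1 p.2)
    (f := fun p : (Fin n → Example K D) × Vec K D => (p.2, p.1 i)) measurable_loss
    (measurable_snd.prodMk hi)
  exact Measurable.lintegral_kernel_prod_right' (κ := sgdPosterior n K D κ) h

/-- The expectation of the empirical risk of the posterior on the data with indices in `T`. -/
noncomputable def expectedRisk {n K D : ℕ} (u : Fin K → ℝ) (σ κ : ℝ≥0) (T : Finset (Fin n)) :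
    ℝ≥0∞ :=
  ∫⁻ s, empRisk T s (sgdPosterior n K D κ s) ∂(sampleLaw n D u σ)

theorem expectedRisk_le {n K D : ℕ} (u : Fin K → ℝ) (σ κ : ℝ≥0) (T : Finset (Fin n)) {r : ℝ≥0∞}
    (h : ∀ i ∈ T, ∫⁻ s, ∫⁻ w, loss w (s i) ∂(sgdPosterior n K D κ s) ∂(sampleLaw n D u σ) ≤ r) :
    expectedRisk (D := D) u σ κ T ≤ r := by
  simp only [expectedRisk, empRisk, ENNReal.div_eq_inv_mul]
  rw [lintegral_const_mul _ (Finset.measurable_fun_sum _ fun i _ => measurable_lintegral_loss κ i),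
    lintegral_finsetSum _ fun i _ => measurable_lintegral_loss κ i]
  have h1 := Finset.sum_le_card_nsmul T _ r h
  rw [nsmul_eq_mul] at h1
  calc _ ≤ (T.card : ℝ≥0∞)⁻¹ * (T.card * r) := by gcongr
    _ = (T.card : ℝ≥0∞)⁻¹ * T.card * r := (mul_assoc _ _ _).symm
    _ ≤ 1 * r := by gcongr; exact ENNReal.inv_mul_le_one _
    _ = r := one_mul r

theorem expectedRisk_le_one {n K D : ℕ} (u : Fin K → ℝ) (σ κ : ℝ≥0) (T : Finset (Fin n)) :
    expectedRisk (D := D) u σ κ T ≤ 1 := by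
  refine expectedRisk_le u σ κ T fun i _ => ?_
  calc _ ≤ ∫⁻ s, ∫⁻ _, 1 ∂(sgdPosterior n K D κ s) ∂(sampleLaw n D u σ) :=
        lintegral_mono fun s => lintegral_mono fun w => loss_le_one _ _
    _ = 1 := by simp

theorem expectedBound_eq {n K D : ℕ} (u : Fin K → ℝ) (σ κ : ℝ≥0) (δ : ℝ) (J : Finset (Fin n))
    {β : ℝ} (hβ : 0 < β) (P : Kernel (J → Example K D) (Vec K D)) [IsMarkovKernel P] :
    expectedBound u σ κ δ J β P = expectedRisk (D := D) u σ κ Jᶜ / ENNReal.ofReal β +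
      (∫⁻ s, klDiv (sgdPosterior n K D κ s) (P fun i => s i) ∂(sampleLaw n D u σ) +
        ENNReal.ofReal (Real.log (1 / δ))) /
      (ENNReal.ofReal (2 * β * (1 - β)) * (Jᶜ.card : ℝ≥0∞)) := by
  have hkl := measurable_klDiv_sgdPosterior κ J P
  simp only [expectedBound, linearBound, expectedRisk, div_eq_mul_inv]
  rw [lintegral_add_right _ ((hkl.add_const _).mul_const _), lintegral_mul_const _
    (hkl.add_const _), lintegral_add_right _ measurable_const, lintegral_const, measure_univ,
    mul_one, lintegral_mul_const' _ _ (by simpa using hβ)]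

theorem expectedBound_oraclePrior_le {n K D : ℕ} (u : Fin K → ℝ) (σ κ : ℝ≥0) (δ : ℝ)
    (J : Finset (Fin n)) {β : ℝ} (hβ : 0 < β) (P : Kernel (J → Example K D) (Vec K D))
    [IsMarkovKernel P] :
    expectedBound (D := D) u σ κ δ J β (oraclePrior u σ κ J) ≤ expectedBound u σ κ δ J β P := by
  rw [expectedBound_eq u σ κ δ J hβ, expectedBound_eq u σ κ δ J hβ]
  gcongr _ + (?_ + _) / _
  exact lintegral_klDiv_oraclePrior_le u σ κ J P

/-- The real form of the dependence of the linear bound on `β` has a minimum in `(0, 1)`. -/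
theorem exists_min_linear_real {a b : ℝ} (ha : 0 ≤ a) (hb : 0 < b) :
    ∃ β ∈ Set.Ioo (0 : ℝ) 1, ∀ β' ∈ Set.Ioo (0 : ℝ) 1,
      a / β + b / (2 * β * (1 - β)) ≤ a / β' + b / (2 * β' * (1 - β')) := by
  set h : ℝ → ℝ := fun β => a / β + b / (2 * β * (1 - β)) with hh
  set M := 2 * a + 2 * b with hM
  have hM0 : 0 < M := by positivity
  set ε := b / (2 * M) with hε
  have hε0 : 0 < ε := by positivity
  have hε1 : ε ≤ 1 / 4 := by rw [hε, div_le_iff₀ (by positivity)]; linarith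
  have hhalf : h (1 / 2) = M := by simp only [hh, hM]; ring
  have hmem : (1 / 2 : ℝ) ∈ Set.Icc ε (1 - ε) := ⟨by linarith, by linarith⟩
  have hcont : ContinuousOn h (Set.Icc ε (1 - ε)) := by
    intro x hx
    have h1 : x ≠ 0 := by linarith [hx.1]
    have h2 : 2 * x * (1 - x) ≠ 0 := mul_ne_zero (by simpa using h1) (by linarith [hx.2])
    exact (ContinuousAt.add (by fun_prop (disch := assumption))
      (by fun_prop (disch := assumption))).continuousWithinAt
  obtain ⟨β, hβ, hmin⟩ := isCompact_Icc.exists_isMinOn ⟨_, hmem⟩ hcont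
  refine ⟨β, ⟨by linarith [hβ.1], by linarith [hβ.2]⟩, fun β' hβ' => ?_⟩
  by_cases hin : β' ∈ Set.Icc ε (1 - ε)
  · exact hmin hin
  · have h1 : h β ≤ M := hhalf ▸ hmin hmem
    have hβ0 := hβ'.1
    have hβ1 : 0 < 1 - β' := by linarith [hβ'.2]
    -- outside the compact interval the second term alone exceeds the value at `1 / 2`
    have h2 : M ≤ b / (2 * β' * (1 - β')) := by
      rw [le_div_iff₀ (by positivity)]
      have hb' : b = ε * (2 * M) := by rw [hε]; field_simp
      have h3 : β' * (1 - β') ≤ ε := by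
        rw [Set.mem_Icc, not_and_or, not_le, not_le] at hin
        rcases hin with h | h <;> nlinarith
      nlinarith
    have h4 : 0 ≤ a / β' := by positivity
    exact h1.trans (by linarith)

/-- A minimising `β` for extended values of the risk term and the complexity term. If `N = 0` or
`B = ∞`, the expression is constantly infinite. -/
theorem exists_min_linear {A B : ℝ≥0∞} (hA : A ≠ ∞) (hB : B ≠ 0) (N : ℕ) :
    ∃ β ∈ Set.Ioo (0 : ℝ) 1, ∀ β' ∈ Set.Ioo (0 : ℝ) 1,
      A / ENNReal.ofReal β + B / (ENNReal.ofReal (2 * β * (1 - β)) * (N : ℝ≥0∞)) ≤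
        A / ENNReal.ofReal β' + B / (ENNReal.ofReal (2 * β' * (1 - β')) * (N : ℝ≥0∞)) := by
  have hhalf : (1 / 2 : ℝ) ∈ Set.Ioo (0 : ℝ) 1 := by norm_num
  rcases Nat.eq_zero_or_pos N with rfl | hN
  · exact ⟨1 / 2, hhalf, fun β' _ => by simp [ENNReal.div_zero hB]⟩
  by_cases hBt : B = ∞
  · refine ⟨1 / 2, hhalf, fun β' _ => ?_⟩
    have h : B / (ENNReal.ofReal (2 * β' * (1 - β')) * (N : ℝ≥0∞)) = ∞ := by
      rw [hBt, ENNReal.top_div_of_ne_top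
        (ENNReal.mul_ne_top ENNReal.ofReal_ne_top (ENNReal.natCast_ne_top N))]
    rw [h, add_top]
    exact le_top
  have hN' : (0 : ℝ) < N := by exact_mod_cast hN
  obtain ⟨β, hβ, hmin⟩ := exists_min_linear_real (a := A.toReal) (b := B.toReal / N)
    ENNReal.toReal_nonneg (div_pos (ENNReal.toReal_pos hB hBt) hN')
  have hval (x : ℝ) (hx : x ∈ Set.Ioo (0 : ℝ) 1) :
      A / ENNReal.ofReal x + B / (ENNReal.ofReal (2 * x * (1 - x)) * (N : ℝ≥0∞)) =
        ENNReal.ofReal (A.toReal / x + B.toReal / N / (2 * x * (1 - x))) := by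
    have hx0 := hx.1
    have hx1 : 0 < 1 - x := by linarith [hx.2]
    have hxx : 0 < 2 * x * (1 - x) := by positivity
    rw [ENNReal.ofReal_add (by positivity) (by positivity), ENNReal.ofReal_div_of_pos hx0,
      ENNReal.ofReal_toReal hA, div_div, mul_comm (N : ℝ),
      ENNReal.ofReal_div_of_pos (by positivity), ENNReal.ofReal_toReal hBt,
      ENNReal.ofReal_mul hxx.le, ENNReal.ofReal_natCast]
  refine ⟨β, hβ, fun β' hβ' => ?_⟩
  rw [hval β hβ, hval β' hβ']
  exact ENNReal.ofReal_le_ofReal (hmin β' hβ')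

/-- The infimum is attained at an oracle prior: the oracle prior is optimal for each `J`, an optimal
`β` exists because the bound blows up at both ends of `(0, 1)`, and there are finitely many `J`. -/
theorem exists_expectedBound_oraclePrior_eq_infBound {n K D : ℕ} (u : Fin K → ℝ) (σ κ : ℝ≥0)
    {δ : ℝ} (hδ : 0 < Real.log (1 / δ)) :
    ∃ J : Finset (Fin n), ∃ β ∈ Set.Ioo (0 : ℝ) 1,
      expectedBound (D := D) u σ κ δ J β (oraclePrior u σ κ J) = infBound n D u σ κ δ := by
  have hβ (J : Finset (Fin n)) : ∃ β ∈ Set.Ioo (0 : ℝ) 1, ∀ β' ∈ Set.Ioo (0 : ℝ) 1,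
      expectedBound (D := D) u σ κ δ J β (oraclePrior u σ κ J) ≤
        expectedBound (D := D) u σ κ δ J β' (oraclePrior u σ κ J) := by
    obtain ⟨β, hβ, hmin⟩ := exists_min_linear
      (A := expectedRisk (D := D) u σ κ Jᶜ)
      (B := ∫⁻ s, klDiv (sgdPosterior n K D κ s) (oraclePrior u σ κ J fun i => s i)
        ∂(sampleLaw n D u σ) + ENNReal.ofReal (Real.log (1 / δ)))
      ((expectedRisk_le_one u σ κ Jᶜ).trans_lt ENNReal.one_lt_top).ne
      (ne_of_gt (lt_of_lt_of_le (ENNReal.ofReal_pos.2 hδ) le_add_self)) Jᶜ.card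
    refine ⟨β, hβ, fun β' hβ' => ?_⟩
    rw [expectedBound_eq u σ κ δ J hβ.1, expectedBound_eq u σ κ δ J hβ'.1]
    exact hmin β' hβ'
  choose b hb hmin using hβ
  obtain ⟨J, hJ⟩ := Finite.exists_min fun J : Finset (Fin n) =>
    expectedBound (D := D) u σ κ δ J (b J) (oraclePrior u σ κ J)
  refine ⟨J, b J, hb J, le_antisymm ?_ ?_⟩
  · refine le_iInf fun J' => le_iInf fun β' => le_iInf fun hβ' =>
      le_iInf fun P => le_iInf fun (hP : IsMarkovKernel P) => ?_
    exact (hJ J').trans ((hmin J' β' hβ').trans (expectedBound_oraclePrior_le u σ κ δ J' hβ'.1 P))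
  · exact iInf_le_of_le J (iInf_le_of_le (b J) (iInf_le_of_le (hb J)
      (iInf_le_of_le (oraclePrior u σ κ J)
        (iInf_le _ (isMarkovKernel_oraclePrior u σ κ J)))))

theorem infBound_le {n K D : ℕ} (u : Fin K → ℝ) (σ κ : ℝ≥0) (δ : ℝ) (J : Finset (Fin n)) {β : ℝ}
    (hβ : β ∈ Set.Ioo (0 : ℝ) 1) (P : Kernel (J → Example K D) (Vec K D)) (hP : IsMarkovKernel P) :
    infBound n D u σ κ δ ≤ expectedBound u σ κ δ J β P :=
  iInf_le_of_le J (iInf_le_of_le β (iInf_le_of_le hβ (iInf_le_of_le P (iInf_le _ hP))))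

/-- A lower bound for every prior that does not depend on the data, whatever the choice of `J`. -/
theorem le_expectedBound_of_ae_eq {n K D : ℕ} (u : Fin K → ℝ) (σ : ℝ≥0) {κ : ℝ≥0} (hκ : κ ≠ 0)
    (δ : ℝ) (J : Finset (Fin n)) {β : ℝ} (hβ : β ∈ Set.Ioo (0 : ℝ) 1)
    (P : Kernel (J → Example K D) (Vec K D)) [IsMarkovKernel P] (p : Measure (Vec K D))
    (hp : ∀ᵐ z ∂(Measure.pi fun _ : J => exampleLaw D u σ), P z = p) :
    (ENNReal.ofReal (D / 2 *
        Real.log (1 + stepSq (Finset.univ : Finset (Fin n)) * (σ ^ 2 / D) / κ)) +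
      ENNReal.ofReal (Real.log (1 / δ))) / (ENNReal.ofReal (1 / 2) * (n : ℝ≥0∞)) ≤
      expectedBound u σ κ δ J β P := by
  have hprob : IsProbabilityMeasure p := by
    obtain ⟨z, hz⟩ := hp.exists
    rw [← hz]
    infer_instance
  have hps : ∀ᵐ s ∂(sampleLaw n D u σ), (P fun i => s i) = p := by
    have h1 : ∀ᵐ q ∂((Measure.pi fun _ : J => exampleLaw D u σ).prod (sampleLaw n D u σ)),
        P q.1 = p := Measure.quasiMeasurePreserving_fst.ae hp
    have h2 : (sampleLaw n D u σ).map (fun s (i : J) => s i) =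
        Measure.pi fun _ : J => exampleLaw D u σ := by
      rw [← (sampleLaw_overwrite D u σ J).map_eq, Measure.map_map (measurable_restrict_sample J)
        (measurable_overwrite J)]
      have h3 : (fun (s : Fin n → Example K D) (i : J) => s i) ∘ overwrite J = Prod.fst := by
        ext1 q
        exact restrict_overwrite J q
      rw [h3, measurePreserving_fst.map_eq]
    rw [← h2] at hp
    exact ae_of_ae_map (measurable_restrict_sample J).aemeasurable hp
  rw [expectedBound_eq u σ κ δ J hβ.1]
  refine le_trans ?_ le_add_self
  have hkl : ∫⁻ s, klDiv (sgdPosterior n K D κ s) (P fun i => s i) ∂(sampleLaw n D u σ) =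
      ∫⁻ s, klDiv (sgdPosterior n K D κ s) p ∂(sampleLaw n D u σ) :=
    lintegral_congr_ae (hps.mono fun s hs => by simp only [hs])
  rw [hkl]
  -- the numerator decreases, and the denominator grows as `2 β (1 - β) ≤ 1 / 2` and `|Jᶜ| ≤ n`
  gcongr
  · exact le_lintegral_klDiv_sgdPosterior u σ hκ p
  · nlinarith [sq_nonneg (β - 1 / 2)]
  · simpa using Finset.card_le_univ Jᶜ

/-! ### Numerical bounds -/

theorem ofReal_ofNat_div (a b : ℕ) [a.AtLeastTwo] [b.AtLeastTwo] :
    ENNReal.ofReal (OfNat.ofNat a / OfNat.ofNat b) = OfNat.ofNat a / OfNat.ofNat b := by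
  rw [ENNReal.ofReal_div_of_pos Nat.ofNat_pos, ENNReal.ofReal_ofNat, ENNReal.ofReal_ofNat]

theorem stepSq_toReal {n : ℕ} (T : Finset (Fin n)) :
    ((stepSq T : ℝ≥0) : ℝ) = ∑ i ∈ T, (1 / ((i : ℝ) + 1)) ^ 2 := by
  rw [stepSq, NNReal.coe_sum]
  rfl

theorem stepSq_univ_bounds : (1.63 : ℝ) ≤ stepSq (Finset.univ : Finset (Fin 100)) ∧
    (stepSq (Finset.univ : Finset (Fin 100)) : ℝ) ≤ 1.64 := by
  rw [stepSq_toReal, Fin.sum_univ_eq_sum_range fun i : ℕ => (1 / ((i : ℝ) + 1)) ^ 2]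
  norm_num [Finset.sum_range_succ]

theorem stepSq_compl_initialSegment_le :
    (stepSq (initialSegment 100 24)ᶜ : ℝ) ≤ 0.0309 := by
  rw [stepSq_toReal, initialSegment, Finset.compl_filter, Finset.sum_filter,
    Fin.sum_univ_eq_sum_range fun i : ℕ => if ¬ i < 24 then (1 / ((i : ℝ) + 1)) ^ 2 else 0]
  norm_num [Finset.sum_range_succ]

theorem card_compl_initialSegment : (initialSegment 100 24)ᶜ.card = 76 := by decide

theorem log_twenty_bounds : 2.97 ≤ Real.log 20 ∧ Real.log 20 ≤ 3.03 := by
  have h : Real.log 20 = 4 * Real.log 2 + Real.log (5 / 4) := by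
    rw [show (20 : ℝ) = 2 ^ 4 * (5 / 4) by norm_num, Real.log_mul (by norm_num) (by norm_num),
      Real.log_pow]
    norm_num
  have h1 := Real.log_two_gt_d9
  have h2 := Real.log_two_lt_d9
  have h3 := Real.log_le_sub_one_of_pos (show (0 : ℝ) < 5 / 4 by norm_num)
  have h4 := Real.one_sub_inv_le_log_of_pos (show (0 : ℝ) < 5 / 4 by norm_num)
  norm_num at h3 h4
  constructor <;> linarith

theorem sum_steps_mul {K : ℕ} {u : Fin K → ℝ}
    (hu : (∑ t ∈ Finset.Icc (1 : ℕ) 100, 1 / (t : ℝ)) * (u ⬝ᵥ u) = 64) :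
    (∑ j : Fin 100, 1 / ((j : ℝ) + 1)) * (u ⬝ᵥ u) = 64 := by
  rw [← hu]
  congr 1
  rw [Fin.sum_univ_eq_sum_range fun j : ℕ => 1 / ((j : ℝ) + 1),
    show Finset.Icc 1 100 = Finset.Ico 1 101 from rfl, Finset.sum_Ico_eq_sum_range]
  refine Finset.sum_congr rfl fun j _ => ?_
  push_cast
  rw [add_comm]

theorem expectedRisk_initialSegment_le {K : ℕ} {u : Fin K → ℝ}
    (hu : (∑ t ∈ Finset.Icc (1 : ℕ) 100, 1 / (t : ℝ)) * (u ⬝ᵥ u) = 64) {κ : ℝ≥0} (hκ : κ ≠ 0)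
    (hκ4 : κ ≤ 4) :
    expectedRisk (D := 1000) u 8 κ (initialSegment 100 24)ᶜ ≤ ENNReal.ofReal (1 / 100) := by
  have hv : ((8 ^ 2 / (1000 : ℕ) : ℝ≥0) : ℝ) = 0.064 := by push_cast; norm_num
  -- `t = 1 / 4` nearly minimises the exponent `-64 t + 32 t² (κ + 0.1)` for `κ = 4`, and
  -- `v' = 60 / 59 v` is just large enough to absorb the resulting `t² (κ + 0.1) |g|² / 2`
  refine expectedRisk_le u 8 κ _ fun i _ => (lintegral_loss_le u (v' := 0.064 * 60 / 59) hκ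
    (by positivity) (by positivity) (show (0 : ℝ) ≤ 1 / 4 by norm_num) ?_ i).trans ?_
  · rw [hv]
    have h1 := stepSq_univ_bounds.2
    have h2 : (κ : ℝ) ≤ 4 := by exact_mod_cast hκ4
    push_cast
    norm_num at h1 ⊢
    linarith
  · rw [sum_steps_mul hu, hv, ← ENNReal.ofReal_mul (Real.exp_pos _).le, ← Real.exp_add]
    refine ENNReal.ofReal_le_ofReal ?_
    have hlog : Real.log ((0.064 * 60 / 59 : ℝ≥0) : ℝ) - Real.log 0.064 ≤ 1 / 59 := by
      rw [← Real.log_div (by positivity) (by norm_num)]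
      refine (Real.log_le_sub_one_of_pos (by positivity)).trans ?_
      push_cast
      norm_num
    have hexp : Real.exp (-(1 / 4) * 64 + (1000 : ℕ) *
        ((Real.log ((0.064 * 60 / 59 : ℝ≥0) : ℝ) - Real.log 0.064) / 2)) ≤ Real.exp (-7) := by
      refine Real.exp_le_exp.2 ?_
      push_cast at hlog ⊢
      linarith
    refine hexp.trans ?_
    rw [Real.exp_neg, inv_le_comm₀ (Real.exp_pos _) (by norm_num)]
    have h7 : Real.exp 7 = Real.exp 1 ^ 7 := by rw [← Real.exp_nat_mul]; norm_num
    rw [h7]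
    calc ((1 / 100 : ℝ))⁻¹ ≤ 2 ^ 7 := by norm_num
      _ ≤ Real.exp 1 ^ 7 := by gcongr; linarith [Real.exp_one_gt_d9]

theorem expectedBound_initialSegment_le {K : ℕ} {u : Fin K → ℝ}
    (hu : (∑ t ∈ Finset.Icc (1 : ℕ) 100, 1 / (t : ℝ)) * (u ⬝ᵥ u) = 64) {κ : ℝ≥0}
    (hκ1 : 9 / 10 ≤ κ) (hκ4 : κ ≤ 4) :
    expectedBound (D := 1000) u 8 κ (1 / 20) (initialSegment 100 24) (1 / 2)
      (oraclePrior u 8 κ (initialSegment 100 24)) ≤ 15 / 100 := by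
  have hκ0 : κ ≠ 0 := (lt_of_lt_of_le (by positivity) hκ1).ne'
  have hκr : (0.9 : ℝ) ≤ κ := by
    have : ((9 / 10 : ℝ≥0) : ℝ) ≤ κ := by exact_mod_cast hκ1
    push_cast at this
    linarith
  have hkl : ∫⁻ s, klDiv (sgdPosterior 100 K 1000 κ s)
      (oraclePrior u 8 κ (initialSegment 100 24) fun i => s i) ∂(sampleLaw 100 1000 u 8) ≤
        ENNReal.ofReal 1.1 := by
    refine (lintegral_klDiv_oraclePrior_le_sq u 8 hκ0 _).trans (ENNReal.ofReal_le_ofReal ?_)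
    have h1 := stepSq_compl_initialSegment_le
    push_cast
    rw [mul_div_assoc', div_le_iff₀ (by positivity)]
    norm_num at h1 ⊢
    linarith
  rw [expectedBound_eq u 8 κ _ _ (by norm_num), card_compl_initialSegment]
  calc _ ≤ ENNReal.ofReal (1 / 100) / ENNReal.ofReal (1 / 2) +
        (ENNReal.ofReal 1.1 + ENNReal.ofReal 3.03) /
          (ENNReal.ofReal (2 * (1 / 2) * (1 - 1 / 2)) * (76 : ℕ)) := by
        have h20 : Real.log (1 / (1 / 20)) ≤ 3.03 := by
          rw [one_div_one_div]; exact log_twenty_bounds.2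
        gcongr
        exact expectedRisk_initialSegment_le hu hκ0 hκ4
    _ = ENNReal.ofReal (1 / 100 / (1 / 2) +
          (1.1 + 3.03) / (2 * (1 / 2) * (1 - 1 / 2) * (76 : ℕ))) := by
        rw [ENNReal.ofReal_add (by norm_num) (by norm_num),
          ENNReal.ofReal_div_of_pos (x := 1 / 100) (by norm_num),
          ENNReal.ofReal_div_of_pos (x := 1.1 + 3.03) (by norm_num),
          ENNReal.ofReal_add (p := 1.1) (by norm_num) (by norm_num),
          ENNReal.ofReal_mul (p := 2 * (1 / 2) * (1 - 1 / 2)) (by norm_num), ENNReal.ofReal_natCast]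
    _ ≤ ENNReal.ofReal (15 / 100) := ENNReal.ofReal_le_ofReal (by norm_num)
    _ = 15 / 100 := ofReal_ofNat_div 15 100

theorem le_expectedBound_of_ae_eq_const {K : ℕ} (u : Fin K → ℝ) {κ : ℝ≥0} {c : ℝ≥0∞}
    (hκ : (κ = 4 ∧ c = 31 / 100) ∨ (κ = 9 / 10 ∧ c = 11 / 10)) (J : Finset (Fin 100)) {β : ℝ}
    (hβ : β ∈ Set.Ioo (0 : ℝ) 1) (P : Kernel (J → Example K 1000) (Vec K 1000)) [IsMarkovKernel P]
    (p : Measure (Vec K 1000))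
    (hp : ∀ᵐ z ∂(Measure.pi fun _ : J => exampleLaw 1000 u 8), P z = p) :
    c ≤ expectedBound u 8 κ (1 / 20) J β P := by
  have hκ0 : κ ≠ 0 := by rcases hκ with ⟨rfl, _⟩ | ⟨rfl, _⟩ <;> positivity
  refine le_trans ?_ (le_expectedBound_of_ae_eq u 8 hκ0 (1 / 20) J hβ P p hp)
  set x : ℝ := stepSq (Finset.univ : Finset (Fin 100)) * ((8 : ℝ≥0) ^ 2 / (1000 : ℕ)) / κ with hx
  have hs := stepSq_univ_bounds.1
  have hx0 : 0 ≤ x := by positivity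
  have hlog := Real.le_log_one_add_of_nonneg hx0
  -- `y` is a decimal lower bound of `x`, and `log (1 + x) ≥ 2 y / (y + 2)`
  have key (r y : ℝ) (hy0 : 0 ≤ y) (hy : y ≤ x) (hr : 50 * r ≤ 500 * (2 * y / (y + 2)) + 2.97) :
      ENNReal.ofReal r ≤
        (ENNReal.ofReal ((1000 : ℕ) / 2 * Real.log (1 + x)) +
          ENNReal.ofReal (Real.log (1 / (1 / 20)))) /
        (ENNReal.ofReal (1 / 2) * ((100 : ℕ) : ℝ≥0∞)) := by
    have h20 : 2.97 ≤ Real.log (1 / (1 / 20)) := by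
      rw [one_div_one_div]; exact log_twenty_bounds.1
    have hxy : 2 * y / (y + 2) ≤ 2 * x / (x + 2) := by
      rw [div_le_div_iff₀ (by positivity) (by positivity)]; nlinarith
    rw [← ENNReal.ofReal_natCast, ← ENNReal.ofReal_mul (by norm_num),
      ← ENNReal.ofReal_add
        (mul_nonneg (by positivity) (Real.log_nonneg (by linarith))) (by linarith),
      ← ENNReal.ofReal_div_of_pos (by norm_num)]
    refine ENNReal.ofReal_le_ofReal ?_
    rw [le_div_iff₀ (by norm_num)]
    push_cast
    linarith
  rcases hκ with ⟨rfl, rfl⟩ | ⟨rfl, rfl⟩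
  · have h := key (31 / 100) 0.026 (by norm_num) (by
      rw [hx]; push_cast; norm_num at hs ⊢; linarith) (by norm_num)
    rwa [ofReal_ofNat_div] at h
  · have h := key (11 / 10) 0.115 (by norm_num) (by
      rw [hx]; push_cast; norm_num at hs ⊢; linarith) (by norm_num)
    rwa [ofReal_ofNat_div] at h

end PacBayes

theorem lemma1 (K : ℕ) (u : Fin K → ℝ)
    (hu : (∑ t ∈ Finset.Icc (1 : ℕ) 100, 1 / (t : ℝ)) * (u ⬝ᵥ u) = 64)
    (κ : ℝ≥0) (c : ℝ≥0∞) (hκ : (κ = 4 ∧ c = 31 / 100) ∨ (κ = 9 / 10 ∧ c = 11 / 10)) :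
    -- the infimum is attained, by a nonempty set and the corresponding oracle prior
    (∃ J : Finset (Fin 100), J.Nonempty ∧ ∃ β ∈ Set.Ioo (0 : ℝ) 1,
      expectedBound (D := 1000) u 8 κ (1 / 20) J β (oraclePrior u 8 κ J) =
        infBound 100 1000 u 8 κ (1 / 20)) ∧
    -- every optimal prior is data dependent
    (∀ (J : Finset (Fin 100)) (β : ℝ) (P : Kernel (J → Example K 1000) (Vec K 1000)),
      β ∈ Set.Ioo (0 : ℝ) 1 → IsMarkovKernel P →
      expectedBound u 8 κ (1 / 20) J β P = infBound 100 1000 u 8 κ (1 / 20) →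
      J.Nonempty ∧ ¬ ∃ p : Measure (Vec K 1000),
        ∀ᵐ z ∂(Measure.pi fun _ : J => exampleLaw 1000 u 8), P z = p) ∧
    -- lower bound for data-independent priors, in particular for the oracle prior
    (∀ (β : ℝ) (P : Kernel ((∅ : Finset (Fin 100)) → Example K 1000) (Vec K 1000)),
      β ∈ Set.Ioo (0 : ℝ) 1 → IsMarkovKernel P →
      c ≤ expectedBound u 8 κ (1 / 20) ∅ β P) ∧
    -- upper bound for the oracle prior given the first 24 data points
    (∃ β ∈ Set.Ioo (0 : ℝ) 1,
      expectedBound (D := 1000) u 8 κ (1 / 20) (initialSegment 100 24) β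
        (oraclePrior u 8 κ (initialSegment 100 24)) ≤ 15 / 100) := by
  have hκ9 : 9 / 10 ≤ κ := by
    rcases hκ with ⟨rfl, _⟩ | ⟨rfl, _⟩
    · exact div_le_of_le_mul₀ (by positivity) (by positivity) (by norm_num)
    · exact le_rfl
  have hκ4 : κ ≤ 4 := by
    rcases hκ with ⟨rfl, _⟩ | ⟨rfl, _⟩
    · exact le_rfl
    · exact div_le_of_le_mul₀ (by positivity) (by positivity) (by norm_num)
  have hhalf : (1 / 2 : ℝ) ∈ Set.Ioo (0 : ℝ) 1 := by norm_num
  have hupper := expectedBound_initialSegment_le hu hκ9 hκ4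
  have hc : 15 / 100 < c := by
    rw [← ofReal_ofNat_div]
    rcases hκ with ⟨_, rfl⟩ | ⟨_, rfl⟩
    · rw [← ofReal_ofNat_div]
      exact (ENNReal.ofReal_lt_ofReal_iff (by norm_num)).2 (by norm_num)
    · rw [← ofReal_ofNat_div]
      exact (ENNReal.ofReal_lt_ofReal_iff (by norm_num)).2 (by norm_num)
  have hinf : infBound 100 1000 u 8 κ (1 / 20) < c :=
    ((infBound_le u 8 κ (1 / 20) _ hhalf _ inferInstance).trans hupper).trans_lt hc
  have hempty (β : ℝ) (P : Kernel ((∅ : Finset (Fin 100)) → Example K 1000) (Vec K 1000))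
      (hβ : β ∈ Set.Ioo (0 : ℝ) 1) (hP : IsMarkovKernel P) :
      c ≤ expectedBound u 8 κ (1 / 20) ∅ β P :=
    le_expectedBound_of_ae_eq_const u hκ ∅ hβ P (P fun i => (Finset.notMem_empty _ i.2).elim)
      (ae_of_all _ fun z => congrArg P (Subsingleton.elim _ _))
  refine ⟨?_, ?_, hempty, 1 / 2, hhalf, hupper⟩
  · obtain ⟨J, β, hβ, h⟩ := exists_expectedBound_oraclePrior_eq_infBound (n := 100) (D := 1000)
      u 8 κ (δ := 1 / 20) (Real.log_pos (by norm_num))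
    refine ⟨J, Finset.nonempty_iff_ne_empty.2 ?_, β, hβ, h⟩
    rintro rfl
    exact absurd (h ▸ hempty β _ hβ inferInstance) hinf.not_ge
  · intro J β P hβ hP h
    refine ⟨Finset.nonempty_iff_ne_empty.2 ?_, ?_⟩
    · rintro rfl
      exact absurd (h ▸ hempty β P hβ hP) hinf.not_ge
    · rintro ⟨p, hp⟩
      exact absurd (h ▸ le_expectedBound_of_ae_eq_const u hκ J hβ P p hp) hinf.not_ge
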